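/- Let $(\Omega,\mathcal F,\mathbb P)$ be a probability space. Let $\{X_j\}_{j\in\mathbb N}$ be i.i.d. real random variables with finite moments of all orders (i.e. $\mathbb E[|X_1|^k]<\infty$ for all $k\in\mathbb N$), and let $m:=\mathbb E[X_1]$. A measurable function $\ell:(0,\infty)\to(0,\infty)$ is called slowly varying if $\lim_{t\to\infty}\ell(at)/\ell(t)=1$ for every $a>0$. Suppose that there are a constant $r\in(0,1)$, slowly varying functions $b,c_1,c_2:(0,\infty)\to(0,\infty)$ and a constant $t^*>0$ such that for all $t\ge t^*$ $$c_1(t)\exp(-b(t)t^r)\le\mathbb P(X_1\ge t)\le c_2(t)\exp(-b(t)t^r).$$ Let $\{\theta_j\}_{j\in\mathbb N}$ be i.i.d. strictly positive random variables, independent of the sequence $\{X_j\}_{j\in\mathbb N}$ and almost surely bounded, with essential supremum $M^*:=\inf\{a\in\mathbb R:\mathbb P(\theta_1>a)=0\}<\infty$. Put $$\bar S_n:=\sum_{j=1}^n\frac{\theta_j}{\sum_{i=1}^n\theta_i}X_j,\qquad n\in\mathbb N.$$ Then for every $x>m$, $$\lim_{n\to\infty}\frac1{b(n)n^r}\log\mathbb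 P\left(\bar S_n\ge x\mid\theta_1,\theta_2,\dots\right)=-\left[\frac{\mathbb E[\theta_1]}{M^*}(x-m)\right]^r\quad\mathbb P\text{-a.s.},$$ and $$\lim_{n\to\infty}\frac1{b(n)n^r}\log\mathbb P\left(\bar S_n\ge x\right)=-\left[\frac{\mathbb E[\theta_1]}{M^*}(x-m)\right]^r.$$ In particular, the quenched and the annealed rates coincide. -/

import Mathlib

open MeasureTheory ProbabilityTheory Filter Topology

/-- A function `ℓ : (0, ∞) → (0, ∞)` (represented by a function on `ℝ` of which only the values on
`(0, ∞)` matter) is slowly varying at infinity: it is positive and (Borel) measurable on `(0, ∞)`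
and `ℓ (a x) / ℓ x → 1` as `x → ∞` for every `a > 0`. -/
structure SlowlyVarying (ℓ : ℝ → ℝ) : Prop where
  pos : ∀ x : ℝ, 0 < x → 0 < ℓ x
  measurable : Measurable (fun x : Set.Ioi (0 : ℝ) => ℓ x)
  tendsto : ∀ a : ℝ, 0 < a → Tendsto (fun x : ℝ => ℓ (a * x) / ℓ x) atTop (𝓝 1)

/-- The self-normalized random weight `θ_j / ∑_{i < n} θ_i` (indices start at `0`). -/
noncomputable def selfNormalizedWeight {Ω : Type*} (θ : ℕ → Ω → ℝ) (n j : ℕ) (ω : Ω) : ℝ :=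
  θ j ω / ∑ i ∈ Finset.range n, θ i ω

/-- The weighted sum `∑_{j < n} a_j(n, θ) X_j` with the self-normalized random weights. -/
noncomputable def randomWeightedSum {Ω : Type*} (θ X : ℕ → Ω → ℝ) (n : ℕ) (ω : Ω) : ℝ :=
  ∑ j ∈ Finset.range n, selfNormalizedWeight θ n j ω * X j ω

/-- The σ-algebra `σ(Y_0, Y_1, …)` generated by a sequence of real random variables. -/
@[reducible] def sigmaOfSequence {Ω : Type*} (Y : ℕ → Ω → ℝ) : MeasurableSpace Ω :=
  MeasurableSpace.comap (fun (ω : Ω) (j : ℕ) => Y j ω) MeasurableSpace.pi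

/-! The mechanism is the principle of one big jump. Given the `θ_j`, the weights are deterministic,
sum to 1, and the largest is about `M* / (n E[θ])`. The cheapest way to lift the sum from `m` to `x`
is to let a single `X_j` of near-maximal weight reach `n (E[θ] / M*) (x - m)` while the others stay
near their mean. Since `t ↦ b(t) t^r` is regularly varying of index `r`, this costs `b(n) n^r [(E[θ]
/ M*)(x - m)]^r` on the logarithmic scale.

Lower bound (`eventually_le_measureReal_weighted_sum`): this scenario, with Chebyshev controlling
the other terms. Upper bound (`eventually_measureReal_weighted_sum_le`): either some `X_j` exceeds
`T = τ n`, which a union bound handles, or all stay below `T`, which a Chernoff bound with slope `s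
= (1 - δ) b(T) T^r / T` handles. The key estimate is that the truncated moment generating function
is `1 + O(s²)`; then `n s²` is negligible against `s T`, because `b(T) T^r = o(T)`.

Both bounds are uniform over bounded weight sequences whose sums have the right order. The quenched
limit follows from the freezing lemma and the strong law. For the annealed limit one integrates over
`θ`: atypically small sums of the `θ_j` have probability `exp(-λ n)`, which is negligible because
`b(n) n^r = o(n)`. -/

/-! ### Slow variation: uniform convergence, Potter bounds, growth of `b(t) t^r`. -/

/-- Uniform convergence theorem for slowly varying functions, in additive form. -/
theorem eventually_forall_abs_sub_lt_of_tendsto_translate {h : ℝ → ℝ} (hm : Measurable h)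
    (ht : ∀ u : ℝ, Tendsto (fun x => h (x + u) - h x) atTop (𝓝 0)) {ε : ℝ} (hε : 0 < ε) :
    ∀ᶠ x in atTop, ∀ u ∈ Set.Icc (0 : ℝ) 1, |h (x + u) - h x| < ε := by
  by_contra hcon
  rw [eventually_atTop] at hcon
  push Not at hcon
  choose y hy u hu hlarge using fun n : ℕ => hcon n
  -- Measure-theoretic contradiction: the good shifts along `y n`, and along `y n + u n`, each fill
  -- `[0, 2]` in the limit. After translation by `u n` both sets lie in `[0, 3]`, so once each has
  -- measure above `3/2` they meet; a common point puts `h (y n)` and `h (y n + u n)` within `ε` of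
  -- each other.
  have key : ∀ z : ℕ → ℝ, (∀ n : ℕ, (n : ℝ) ≤ z n) →
      (∀ n, MeasurableSet {t | t ∈ Set.Icc (0 : ℝ) 2 ∧ ∀ k ≥ n, |h (z k + t) - h (z k)| < ε / 2}) ∧
      Tendsto (fun n => volume {t | t ∈ Set.Icc (0 : ℝ) 2 ∧
        ∀ k ≥ n, |h (z k + t) - h (z k)| < ε / 2}) atTop (𝓝 2) := by
    intro z hz
    have hzt : Tendsto z atTop atTop := tendsto_atTop_mono hz tendsto_natCast_atTop_atTop
    refine ⟨fun n => ?_, ?_⟩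
    · refine measurableSet_Icc.inter ?_
      refine MeasurableSet.congr (s := ⋂ k, ⋂ (_ : k ≥ n), {t | |h (z k + t) - h (z k)| < ε / 2})
        ?_ (by ext; simp; rfl)
      refine MeasurableSet.iInter fun k => MeasurableSet.iInter fun _ => ?_
      exact measurableSet_lt (by fun_prop) measurable_const
    · have hU : (⋃ n : ℕ, {t | t ∈ Set.Icc (0 : ℝ) 2 ∧
          ∀ k ≥ n, |h (z k + t) - h (z k)| < ε / 2}) = Set.Icc (0 : ℝ) 2 := by
        ext t
        simp only [Set.mem_iUnion, Set.mem_ofPred_eq]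
        constructor
        · rintro ⟨n, h1, -⟩
          exact h1
        · intro h1
          have h2 := ((ht t).comp hzt).eventually (Metric.ball_mem_nhds 0 (half_pos hε))
          obtain ⟨n, hn⟩ := eventually_atTop.1 h2
          exact ⟨n, h1, fun k hk => by simpa [Real.dist_eq] using hn k hk⟩
      have hmono : Monotone (fun n : ℕ => {t | t ∈ Set.Icc (0 : ℝ) 2 ∧
          ∀ k ≥ n, |h (z k + t) - h (z k)| < ε / 2}) :=
        fun a b hab t hta => ⟨hta.1, fun k hk => hta.2 k (hab.trans hk)⟩
      have := tendsto_measure_iUnion_atTop (μ := volume) hmono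
      rw [hU, Real.volume_Icc] at this
      simpa [Function.comp_def] using this
  obtain ⟨hV, hVt⟩ := key y hy
  obtain ⟨hW, hWt⟩ := key (fun n => y n + u n) (fun n => (hy n).trans (by linarith [(hu n).1]))
  have h32 : ENNReal.ofReal (3 / 2) < 2 := by
    rw [show (2 : ENNReal) = ENNReal.ofReal 2 by simp]
    exact (ENNReal.ofReal_lt_ofReal_iff (by norm_num)).2 (by norm_num)
  obtain ⟨n, hn1, hn2⟩ := ((hVt.eventually (lt_mem_nhds h32)).and
    (hWt.eventually (lt_mem_nhds h32))).exists
  set V := {t | t ∈ Set.Icc (0 : ℝ) 2 ∧ ∀ k ≥ n, |h (y k + t) - h (y k)| < ε / 2} with hVdef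
  set W := {t | t ∈ Set.Icc (0 : ℝ) 2 ∧ ∀ k ≥ n, |h (y k + u k + t) - h (y k + u k)| < ε / 2}
    with hWdef
  have hWm : MeasurableSet W := hW n
  have hsh : volume ((fun t => t + (-u n)) ⁻¹' W) = volume W := measure_preimage_add_right _ _ _
  have hdisj : Disjoint V ((fun t => t + (-u n)) ⁻¹' W) := by
    rw [Set.disjoint_left]
    rintro t ⟨-, h1⟩ ⟨-, h2⟩
    have h1 := h1 n le_rfl
    have h2 := h2 n le_rfl
    rw [show y n + u n + (t + -u n) = y n + t by ring] at h2
    have h3 := hlarge n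
    rw [abs_lt] at h1 h2
    rcases le_abs.1 h3 with h3 | h3 <;> linarith [h1.1, h1.2, h2.1, h2.2]
  have hsub : V ∪ ((fun t => t + (-u n)) ⁻¹' W) ⊆ Set.Icc (0 : ℝ) 3 := by
    rintro t (h1 | h1)
    · exact ⟨h1.1.1, h1.1.2.trans (by norm_num)⟩
    · have h2 := h1.1.1
      have h3 := h1.1.2
      have h4 := (hu n).1
      have h5 := (hu n).2
      simp only at h2 h3
      exact ⟨by linarith, by linarith⟩
  have hle := measure_mono (μ := volume) hsub
  rw [measure_union hdisj (hWm.preimage (by fun_prop)), hsh, Real.volume_Icc] at hle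
  have hlt : ENNReal.ofReal (3 / 2) + ENNReal.ofReal (3 / 2) < volume V + volume W :=
    ENNReal.add_lt_add hn1 hn2
  rw [← ENNReal.ofReal_add (by norm_num) (by norm_num)] at hlt
  norm_num at hlt hle
  exact absurd hle (not_le.2 hlt)

namespace SlowlyVarying

variable {ℓ : ℝ → ℝ}

/-- Potter-type bound. -/
theorem exists_abs_log_sub_log_le (hℓ : SlowlyVarying ℓ) {ε : ℝ} (hε : 0 < ε) :
    ∃ t₀ : ℝ, 1 ≤ t₀ ∧ ∀ t ≥ t₀, ∀ s ≥ t,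
      |Real.log (ℓ s) - Real.log (ℓ t)| ≤ ε * (Real.log s - Real.log t + 1) := by
  set h : ℝ → ℝ := fun y => Real.log (ℓ (Real.exp y)) with hh
  have hm : Measurable h := by
    have : Measurable (fun y : ℝ => (⟨Real.exp y, Real.exp_pos y⟩ : Set.Ioi (0 : ℝ))) :=
      Real.measurable_exp.subtype_mk
    exact Real.measurable_log.comp (hℓ.measurable.comp this)
  have ht : ∀ u : ℝ, Tendsto (fun x => h (x + u) - h x) atTop (𝓝 0) := by
    intro u
    have h1 := (hℓ.tendsto (Real.exp u) (Real.exp_pos u)).comp Real.tendsto_exp_atTop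
    have h2 := (Real.continuousAt_log one_ne_zero).tendsto.comp h1
    rw [Real.log_one] at h2
    refine h2.congr fun x => ?_
    simp only [Function.comp, hh]
    rw [Real.log_div (hℓ.pos _ (by positivity)).ne' (hℓ.pos _ (by positivity)).ne',
      ← Real.exp_add, add_comm u x]
  obtain ⟨x₀, hx₀⟩ := eventually_atTop.1
    (eventually_forall_abs_sub_lt_of_tendsto_translate hm ht hε)
  -- Chaining unit steps, each costing at most `ε`.
  have hind : ∀ n : ℕ, ∀ x ≥ x₀, ∀ u : ℝ, 0 ≤ u → u ≤ n + 1 → |h (x + u) - h x| ≤ ε * (u + 1) := by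
    intro n
    induction n with
    | zero =>
      intro x hx u h0 h1
      refine (hx₀ x hx u ⟨h0, by simpa using h1⟩).le.trans ?_
      nlinarith
    | succ n ih =>
      intro x hx u h0 h1
      by_cases hu : u ≤ 1
      · refine (hx₀ x hx u ⟨h0, hu⟩).le.trans ?_
        nlinarith
      · push Not at hu
        push_cast at h1
        have h2 := ih (x + 1) (by linarith) (u - 1) (by linarith) (by linarith)
        have h3 := (hx₀ x hx 1 ⟨zero_le_one, le_rfl⟩).le
        rw [show x + 1 + (u - 1) = x + u by ring] at h2
        calc |h (x + u) - h x| = |(h (x + u) - h (x + 1)) + (h (x + 1) - h x)| := by ring_nf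
          _ ≤ _ := abs_add_le _ _
          _ ≤ ε * (u - 1 + 1) + ε := by linarith
          _ = _ := by ring
  refine ⟨max 1 (Real.exp x₀), le_max_left _ _, fun t htt s hs => ?_⟩
  have ht1 : 1 ≤ t := (le_max_left _ _).trans htt
  have ht2 : x₀ ≤ Real.log t := by
    rw [Real.le_log_iff_exp_le (by linarith)]
    exact (le_max_right _ _).trans htt
  have hu : 0 ≤ Real.log s - Real.log t := sub_nonneg.2 (Real.log_le_log (by linarith) hs)
  obtain ⟨n, hn⟩ := exists_nat_ge (Real.log s - Real.log t)
  have := hind n (Real.log t) ht2 _ hu (by linarith)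
  simp only [hh, add_sub_cancel] at this
  rwa [Real.exp_log (by linarith), Real.exp_log (by linarith)] at this

/-- The logarithm of a slowly varying function is `o(log t)`. -/
theorem eventually_abs_log_le (hℓ : SlowlyVarying ℓ) {ε : ℝ} (hε : 0 < ε) :
    ∀ᶠ t in atTop, |Real.log (ℓ t)| ≤ ε * Real.log t := by
  obtain ⟨t₀, h1, h2⟩ := hℓ.exists_abs_log_sub_log_le (half_pos hε)
  have h3 := Real.tendsto_log_atTop.eventually_ge_atTop
    ((|Real.log (ℓ t₀)| + ε / 2) / (ε / 2))
  filter_upwards [h3, eventually_ge_atTop t₀] with t h4 h5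
  have h6 := h2 t₀ le_rfl t h5
  rw [div_le_iff₀ (half_pos hε)] at h4
  have h7 : 0 ≤ Real.log t₀ := Real.log_nonneg h1
  have h8 := abs_sub_abs_le_abs_sub (Real.log (ℓ t)) (Real.log (ℓ t₀))
  nlinarith

variable {r : ℝ}

theorem eventually_rpow_le_mul_rpow (hℓ : SlowlyVarying ℓ) {p : ℝ} (hp : p < r) :
    ∀ᶠ t in atTop, t ^ p ≤ ℓ t * t ^ r := by
  filter_upwards [hℓ.eventually_abs_log_le (sub_pos.2 hp), eventually_gt_atTop 0] with t h1 ht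
  have h2 : t ^ (p - r) ≤ ℓ t := by
    rw [Real.rpow_def_of_pos ht, ← Real.le_log_iff_exp_le (hℓ.pos t ht)]
    have := neg_abs_le (Real.log (ℓ t))
    linarith
  calc t ^ p = t ^ (p - r) * t ^ r := by rw [← Real.rpow_add ht]; ring_nf
    _ ≤ _ := by gcongr

theorem eventually_mul_rpow_le_rpow (hℓ : SlowlyVarying ℓ) {p : ℝ} (hp : r < p) :
    ∀ᶠ t in atTop, ℓ t * t ^ r ≤ t ^ p := by
  filter_upwards [hℓ.eventually_abs_log_le (sub_pos.2 hp), eventually_gt_atTop 0] with t h1 ht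
  have h2 : ℓ t ≤ t ^ (p - r) := by
    rw [Real.rpow_def_of_pos ht, ← Real.log_le_iff_le_exp (hℓ.pos t ht)]
    have := le_abs_self (Real.log (ℓ t))
    linarith
  calc ℓ t * t ^ r ≤ t ^ (p - r) * t ^ r := by gcongr
    _ = _ := by rw [← Real.rpow_add ht]; ring_nf

theorem tendsto_mul_rpow_atTop (hℓ : SlowlyVarying ℓ) (hr : 0 < r) :
    Tendsto (fun t => ℓ t * t ^ r) atTop atTop :=
  tendsto_atTop_mono' _ (hℓ.eventually_rpow_le_mul_rpow (half_lt_self hr))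
    (tendsto_rpow_atTop (half_pos hr))

theorem tendsto_mul_rpow_div_zero (hℓ : SlowlyVarying ℓ) (hr : r < 1) :
    Tendsto (fun t => ℓ t * t ^ r / t) atTop (𝓝 0) := by
  have hp : 0 < (1 - r) / 2 := by linarith
  refine squeeze_zero' ?_ ?_ (tendsto_rpow_neg_atTop hp)
  · filter_upwards [eventually_gt_atTop 0] with t ht
    have := hℓ.pos t ht
    positivity
  · filter_upwards [hℓ.eventually_mul_rpow_le_rpow (show r < (1 + r) / 2 by linarith),
      eventually_gt_atTop 0] with t h1 ht
    rw [div_le_iff₀ ht]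
    refine h1.trans (le_of_eq ?_)
    nth_rewrite 3 [← Real.rpow_one t]
    rw [← Real.rpow_add ht]
    ring_nf

theorem tendsto_log_div_mul_rpow_zero (hℓ : SlowlyVarying ℓ) (hr : 0 < r) :
    Tendsto (fun t => Real.log t / (ℓ t * t ^ r)) atTop (𝓝 0) := by
  have h0 : Tendsto (fun t : ℝ => Real.log t / t ^ (r / 2)) atTop (𝓝 0) :=
    (isLittleO_log_rpow_atTop (half_pos hr)).tendsto_div_nhds_zero
  refine squeeze_zero' ?_ ?_ h0
  · filter_upwards [eventually_ge_atTop 1] with t ht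
    have := hℓ.pos t (by linarith)
    have := Real.log_nonneg ht
    positivity
  · filter_upwards [hℓ.eventually_rpow_le_mul_rpow (half_lt_self hr),
      eventually_ge_atTop 1] with t h1 ht
    have := Real.log_nonneg ht
    gcongr

theorem tendsto_log_slowlyVarying_div_mul_rpow_zero {k : ℝ → ℝ} (hk : SlowlyVarying k)
    (hℓ : SlowlyVarying ℓ) (hr : 0 < r) :
    Tendsto (fun t => Real.log (k t) / (ℓ t * t ^ r)) atTop (𝓝 0) := by
  refine squeeze_zero_norm' ?_ (hℓ.tendsto_log_div_mul_rpow_zero hr)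
  filter_upwards [hk.eventually_abs_log_le zero_lt_one, eventually_gt_atTop 0] with t h1 ht
  have h3 : 0 < ℓ t * t ^ r := mul_pos (hℓ.pos t ht) (by positivity)
  rw [norm_div, Real.norm_eq_abs, Real.norm_of_nonneg h3.le]
  gcongr
  linarith

theorem tendsto_mul_rpow_comp_mul_div (hℓ : SlowlyVarying ℓ) {κ : ℝ} (hκ : 0 < κ) :
    Tendsto (fun t => ℓ (κ * t) * (κ * t) ^ r / (ℓ t * t ^ r)) atTop (𝓝 (κ ^ r)) := by
  have h1 := (hℓ.tendsto κ hκ).mul_const (κ ^ r)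
  rw [one_mul] at h1
  refine h1.congr' ?_
  filter_upwards [eventually_gt_atTop 0] with t ht
  rw [Real.mul_rpow hκ.le ht.le]
  have := hℓ.pos t ht
  have : 0 < t ^ r := by positivity
  field_simp

/-- For `r < 1`, the function `t ↦ ℓ(t) t^(r-1)` is almost decreasing. -/
theorem exists_mul_rpow_div_le (hℓ : SlowlyVarying ℓ) (hr : r < 1) {δ : ℝ} (hδ : 0 < δ) :
    ∃ t₀ : ℝ, 1 ≤ t₀ ∧ ∀ t ≥ t₀, ∀ s ≥ t,
      ℓ s * s ^ r / s ≤ (1 + δ) * (ℓ t * t ^ r / t) := by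
  have hlog : 0 < Real.log (1 + δ) := Real.log_pos (by linarith)
  -- In the Potter bound, `1 - r` absorbs the term growing with `log s - log t` and `log (1 + δ)`
  -- absorbs the additive constant.
  have hε : 0 < min (1 - r) (Real.log (1 + δ)) := lt_min (by linarith) hlog
  obtain ⟨t₀, h1, h2⟩ := hℓ.exists_abs_log_sub_log_le hε
  refine ⟨t₀, h1, fun t ht s hs => ?_⟩
  have ht0 : 0 < t := by linarith
  have hs0 : 0 < s := by linarith
  have hlt := hℓ.pos t ht0
  have hls := hℓ.pos s hs0
  have htr : 0 < t ^ r := by positivity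
  have hsr : 0 < s ^ r := by positivity
  rw [← Real.log_le_log_iff (by positivity) (by positivity),
    Real.log_mul (by positivity) (by positivity), Real.log_div (by positivity) hs0.ne',
    Real.log_div (by positivity) ht0.ne', Real.log_mul hls.ne' hsr.ne',
    Real.log_mul hlt.ne' htr.ne', Real.log_rpow hs0, Real.log_rpow ht0]
  have h3 := (le_abs_self _).trans (h2 t ht s hs)
  have h4 : 0 ≤ Real.log s - Real.log t := sub_nonneg.2 (Real.log_le_log ht0 hs)
  have h5 := min_le_left (1 - r) (Real.log (1 + δ))
  have h6 := min_le_right (1 - r) (Real.log (1 + δ))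
  nlinarith

end SlowlyVarying

/-! ### Logarithmic asymptotics of the tail. -/

section Tail

variable {F b : ℝ → ℝ} {r : ℝ}

/-- The prefactors disappear because the logarithm of a slowly varying function is `o(log t)`. Later
estimates use the tail only through this limit and its eventual positivity. -/
theorem tendsto_log_div_of_slowlyVarying_bounds {c₁ c₂ : ℝ → ℝ} (hr0 : 0 < r)
    (hb : SlowlyVarying b) (hc₁ : SlowlyVarying c₁) (hc₂ : SlowlyVarying c₂)
    (hF : ∀ᶠ t in atTop, c₁ t * Real.exp (-(b t) * t ^ r) ≤ F t ∧
      F t ≤ c₂ t * Real.exp (-(b t) * t ^ r)) :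
    (∀ᶠ t in atTop, 0 < F t) ∧
      Tendsto (fun t => Real.log (F t) / (b t * t ^ r)) atTop (𝓝 (-1)) := by
  have hpos : ∀ᶠ t in atTop, 0 < F t := by
    filter_upwards [hF, eventually_gt_atTop 0] with t h1 ht
    exact (mul_pos (hc₁.pos t ht) (Real.exp_pos _)).trans_le h1.1
  refine ⟨hpos, ?_⟩
  have h1 := (hc₁.tendsto_log_slowlyVarying_div_mul_rpow_zero hb hr0).sub_const 1
  have h2 := (hc₂.tendsto_log_slowlyVarying_div_mul_rpow_zero hb hr0).sub_const 1
  rw [zero_sub] at h1 h2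
  have hlog : ∀ c : ℝ → ℝ, SlowlyVarying c → ∀ t > 0,
      Real.log (c t) / (b t * t ^ r) - 1 =
        Real.log (c t * Real.exp (-(b t) * t ^ r)) / (b t * t ^ r) := by
    intro c hc t ht
    have := hb.pos t ht
    have : 0 < t ^ r := by positivity
    rw [Real.log_mul (hc.pos t ht).ne' (Real.exp_pos _).ne', Real.log_exp]
    field_simp
    ring
  refine tendsto_of_tendsto_of_tendsto_of_le_of_le' h1 h2 ?_ ?_
  · filter_upwards [hF, eventually_gt_atTop 0] with t h3 ht
    have := hb.pos t ht
    have := hc₁.pos t ht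
    rw [hlog c₁ hc₁ t ht]
    gcongr
    exact h3.1
  · filter_upwards [hF, hpos, eventually_gt_atTop 0] with t h3 h4 ht
    have := hb.pos t ht
    rw [hlog c₂ hc₂ t ht]
    gcongr
    exact h3.2

theorem tendsto_log_comp_mul_div (hb : SlowlyVarying b)
    (hF : Tendsto (fun t => Real.log (F t) / (b t * t ^ r)) atTop (𝓝 (-1)))
    {κ : ℝ} (hκ : 0 < κ) :
    Tendsto (fun t => Real.log (F (κ * t)) / (b t * t ^ r)) atTop (𝓝 (-κ ^ r)) := by
  have h1 := hF.comp (tendsto_id.const_mul_atTop hκ)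
  have h2 := h1.mul (hb.tendsto_mul_rpow_comp_mul_div (r := r) hκ)
  rw [neg_one_mul] at h2
  refine h2.congr' ?_
  filter_upwards [eventually_gt_atTop 0] with t ht
  have := hb.pos t ht
  have := hb.pos (κ * t) (by positivity)
  have : 0 < t ^ r := by positivity
  have : 0 < (κ * t) ^ r := by positivity
  simp only [Function.comp, id]
  field_simp

/-- The factor `t` pays for a union bound over `n` variables; the factor 2 leaves half of the budget
to the Chernoff term. -/
theorem eventually_two_mul_mul_le_exp (hr0 : 0 < r) (hb : SlowlyVarying b)
    (hpos : ∀ᶠ t in atTop, 0 < F t)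
    (hF : Tendsto (fun t => Real.log (F t) / (b t * t ^ r)) atTop (𝓝 (-1)))
    {κ K : ℝ} (hκ : 0 < κ) (hK : K < κ ^ r) :
    ∀ᶠ t in atTop, 2 * (t * F (κ * t)) ≤ Real.exp (-K * (b t * t ^ r)) := by
  have h1 := tendsto_log_comp_mul_div hb hF hκ
  have h2 := hb.tendsto_log_div_mul_rpow_zero hr0
  have h3 : Tendsto (fun t => Real.log 2 / (b t * t ^ r)) atTop (𝓝 0) :=
    (hb.tendsto_mul_rpow_atTop hr0).const_div_atTop _
  have h4 := (h3.add (h2.add h1)).eventually (gt_mem_nhds (show 0 + (0 + -κ ^ r) < -K by linarith))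
  filter_upwards [h4, eventually_gt_atTop 0,
    (tendsto_id.const_mul_atTop hκ).eventually hpos] with t h5 ht h6
  have := hb.pos t ht
  have : 0 < b t * t ^ r := by positivity
  simp only [id] at h6
  rw [← Real.log_le_iff_le_exp (by positivity), Real.log_mul (by norm_num) (by positivity),
    Real.log_mul ht.ne' h6.ne']
  rw [← add_div, ← add_div, div_lt_iff₀ this] at h5
  exact h5.le

/-- The factor 2 compensates the probability `1/2` with which the variables that do not jump behave
typically. -/
theorem eventually_two_mul_exp_le (hr0 : 0 < r) (hb : SlowlyVarying b)
    (hpos : ∀ᶠ t in atTop, 0 < F t)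
    (hF : Tendsto (fun t => Real.log (F t) / (b t * t ^ r)) atTop (𝓝 (-1)))
    {κ K : ℝ} (hκ : 0 < κ) (hK : κ ^ r < K) :
    ∀ᶠ t in atTop, 2 * Real.exp (-K * (b t * t ^ r)) ≤ F (κ * t) := by
  have h1 := tendsto_log_comp_mul_div hb hF hκ
  have h3 : Tendsto (fun t => Real.log 2 / (b t * t ^ r)) atTop (𝓝 0) :=
    (hb.tendsto_mul_rpow_atTop hr0).const_div_atTop _
  have h4 := (h1.sub h3).eventually (lt_mem_nhds (show -K < -κ ^ r - 0 by linarith))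
  filter_upwards [h4, eventually_gt_atTop 0,
    (tendsto_id.const_mul_atTop hκ).eventually hpos] with t h5 ht h6
  have := hb.pos t ht
  have : 0 < b t * t ^ r := by positivity
  simp only [id] at h6
  rw [← sub_div, lt_div_iff₀ this] at h5
  rw [← Real.log_le_log_iff (by positivity) h6, Real.log_mul (by norm_num) (Real.exp_pos _).ne',
    Real.log_exp]
  linarith

end Tail

/-! ### Exponential moments of truncated variables. -/

/-- Only the positive part of `y` enters the remainder, so a second moment suffices for the left
tail. Both cases come from `1 - y ≤ exp (-y)`; for `y ≤ 0` one also uses `(1 + y + y²)(1 - y) = 1 -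
y³ ≥ 1`. -/
theorem Real.exp_le_one_add_add_sq_mul_exp (y : ℝ) :
    Real.exp y ≤ 1 + y + y ^ 2 * Real.exp (max y 0) := by
  rcases le_total y 0 with h | h
  · rw [max_eq_right h, Real.exp_zero, mul_one]
    have h1 := Real.add_one_le_exp (-y)
    have h2 : Real.exp y * Real.exp (-y) = 1 := by rw [← Real.exp_add]; simp
    have h3 : Real.exp y * (1 - y) ≤ 1 := by nlinarith [Real.exp_pos y]
    have h4 : 0 ≤ -y ^ 3 := by
      have : 0 ≤ (-y) ^ 3 := pow_nonneg (by linarith) 3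
      linarith [show (-y) ^ 3 = -y ^ 3 by ring]
    have h5 : Real.exp y * (1 - y) ≤ (1 + y + y ^ 2) * (1 - y) := by nlinarith
    exact le_of_mul_le_mul_right h5 (by linarith)
  · rw [max_eq_left h]
    have h1 := Real.add_one_le_exp (-y)
    have h2 : Real.exp y * Real.exp (-y) = 1 := by rw [← Real.exp_add]; simp
    have h3 : Real.exp y - 1 ≤ y * Real.exp y := by nlinarith [Real.exp_pos y]
    have h4 := mul_le_mul_of_nonneg_left h3 h
    nlinarith

/-- A nonnegative function of a natural-number-valued random variable is integrable when the series
weighted by the tails converges. -/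
theorem integrable_comp_of_summable_tail {Ω : Type*} [MeasurableSpace Ω] {μ : Measure Ω}
    [IsFiniteMeasure μ] {N : Ω → ℕ} (hN : Measurable N) {H : ℕ → ℝ} (hH : ∀ k, 0 ≤ H k)
    (hs : Summable fun k => H k * μ.real {ω | k ≤ N ω}) : Integrable (fun ω => H (N ω)) μ := by
  have hHm : Measurable H := measurable_of_countable H
  refine ⟨(hHm.comp hN).aestronglyMeasurable, ?_⟩
  rw [hasFiniteIntegral_iff_ofReal (ae_of_all _ fun ω => hH _)]
  have h1 : ∫⁻ ω, ENNReal.ofReal (H (N ω)) ∂μ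
      = ∫⁻ k, ENNReal.ofReal (H k) ∂(μ.map N) :=
    (lintegral_map (f := fun k => ENNReal.ofReal (H k)) hHm.ennreal_ofReal hN).symm
  rw [h1, lintegral_countable']
  refine lt_of_le_of_lt (ENNReal.tsum_le_tsum (g := fun k =>
    ENNReal.ofReal (H k * μ.real {ω | k ≤ N ω})) fun k => ?_) hs.tsum_ofReal_lt_top
  rw [ENNReal.ofReal_mul (hH k), Measure.map_apply hN (measurableSet_singleton k)]
  gcongr
  rw [measureReal_def, ENNReal.ofReal_toReal (measure_ne_top _ _)]
  refine measure_mono fun ω hω => ?_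
  simp only [Set.mem_preimage, Set.mem_singleton_iff] at hω
  simp [hω]

section TruncatedExponentialMoment

variable {Ω : Type*} [MeasurableSpace Ω] {μ : Measure Ω} [IsProbabilityMeasure μ] {b : ℝ → ℝ}
  {r : ℝ}

theorem summable_mul_tail {F : ℝ → ℝ} (hF0 : ∀ t, 0 ≤ F t) (hr0 : 0 < r) (hb : SlowlyVarying b)
    (hpos : ∀ᶠ t in atTop, 0 < F t)
    (hF : Tendsto (fun t => Real.log (F t) / (b t * t ^ r)) atTop (𝓝 (-1)))
    {δ : ℝ} (hδ0 : 0 < δ) (a : ℝ) :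
    Summable fun k : ℕ => ((k : ℝ) + 1 + |a|) ^ 2 *
      Real.exp ((1 - δ) * (1 + δ / 4) * (b k * (k : ℝ) ^ r)) * F k := by
  have hev : ∀ᶠ t : ℝ in atTop, (t + 1 + |a|) ^ 2 *
      Real.exp ((1 - δ) * (1 + δ / 4) * (b t * t ^ r)) * F t ≤ (2 + |a|) ^ 2 * (1 / t ^ 2) := by
    -- The exponent `(1 - δ)(1 + δ/4)` falls short of `1 - δ/4` by more than `δ/2`; since `log t` is
    -- at most `δ/8` times `b(t) t^r`, this gap yields a factor `t⁻⁴`.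
    filter_upwards [hF.eventually (gt_mem_nhds (show -1 < -(1 - δ / 4) by linarith)), hpos,
      (hb.tendsto_log_div_mul_rpow_zero hr0).eventually (gt_mem_nhds (show 0 < δ / 8 by linarith)),
      eventually_ge_atTop 1] with t h1 h2 h3 h4
    have ht : 0 < t := by linarith
    have := hb.pos t ht
    have hφ : 0 < b t * t ^ r := by positivity
    rw [div_lt_iff₀ hφ] at h1 h3
    have h5 : F t ≤ Real.exp (-(1 - δ / 4) * (b t * t ^ r)) :=
      (Real.log_le_iff_le_exp h2).1 h1.le
    have h6 : Real.exp ((1 - δ) * (1 + δ / 4) * (b t * t ^ r)) * F t ≤ 1 / t ^ 4 := by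
      calc _ ≤ Real.exp ((1 - δ) * (1 + δ / 4) * (b t * t ^ r)) *
            Real.exp (-(1 - δ / 4) * (b t * t ^ r)) := by gcongr
        _ ≤ Real.exp (-(4 * Real.log t)) := by
          rw [← Real.exp_add]
          gcongr
          nlinarith [mul_pos (sq_pos_of_pos hδ0) hφ]
        _ = 1 / t ^ 4 := by
          rw [Real.exp_neg, mul_comm, Real.exp_mul, Real.exp_log ht, one_div]
          norm_cast
    rw [mul_assoc]
    calc _ ≤ ((2 + |a|) * t) ^ 2 * (1 / t ^ 4) := by
          have : t + 1 + |a| ≤ (2 + |a|) * t := by nlinarith [abs_nonneg a]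
          gcongr
      _ = _ := by field_simp
  refine Summable.of_norm_bounded_eventually_nat
    ((Real.summable_one_div_nat_pow.2 (by norm_num : 1 < 2)).mul_left ((2 + |a|) ^ 2)) ?_
  filter_upwards [tendsto_natCast_atTop_atTop.eventually hev] with k hk
  rw [Real.norm_of_nonneg (mul_nonneg (by positivity) (hF0 _))]
  exact hk

/-- Centering removes the linear term, so what matters is a quadratic remainder bounded uniformly in
`T` and `w`. As `b(t) t^r / t` is almost decreasing, the slope at `T` is dominated by the slope at
any large `z < T`, whence `s z` is at most about `(1 - δ)(1 + δ/4) b(z) z^r`, which the tail of `Z`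
integrates. -/
theorem exists_truncated_exponential_moment_le {Z : Ω → ℝ} (hZ : Measurable Z) (hZ2 : MemLp Z 2 μ)
    (hr0 : 0 < r) (hr1 : r < 1) (hb : SlowlyVarying b)
    (hpos : ∀ᶠ t in atTop, 0 < μ.real {ω | t ≤ Z ω})
    (hF : Tendsto (fun t => Real.log (μ.real {ω | t ≤ Z ω}) / (b t * t ^ r)) atTop (𝓝 (-1)))
    {δ : ℝ} (hδ0 : 0 < δ) (hδ1 : δ < 1) :
    ∃ D : ℝ, 0 ≤ D ∧ ∀ᶠ T in atTop, ∀ w ∈ Set.Icc (0 : ℝ) 1,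
      ∫ ω, (Set.Iio T).indicator
        (fun z => Real.exp ((1 - δ) * (b T * T ^ r / T) * (w * (z - ∫ ω, Z ω ∂μ)))) (Z ω) ∂μ ≤
        1 + ((1 - δ) * (b T * T ^ r / T)) ^ 2 * D := by
  set m := ∫ ω, Z ω ∂μ with hm
  set H : ℕ → ℝ := fun k => ((k : ℝ) + 1 + |m|) ^ 2 *
      Real.exp ((1 - δ) * (1 + δ / 4) * (b k * (k : ℝ) ^ r)) with hH
  have hH0 : ∀ k, 0 ≤ H k := fun k => by positivity
  have hNm : Measurable fun ω => ⌊Z ω⌋₊ := Nat.measurable_floor.comp hZ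
  have hHint : Integrable (fun ω => H ⌊Z ω⌋₊) μ := by
    refine integrable_comp_of_summable_tail hNm hH0 ?_
    refine Summable.of_norm_bounded_eventually_nat
      (summable_mul_tail (fun t => measureReal_nonneg) hr0 hb hpos hF hδ0 m) ?_
    filter_upwards [eventually_ge_atTop 1] with k hk
    rw [Real.norm_of_nonneg (mul_nonneg (hH0 k) measureReal_nonneg)]
    refine le_of_eq ?_
    congr 3
    ext ω
    exact Nat.le_floor_iff' (by omega)
  have hZint : Integrable Z μ := hZ2.integrable (by norm_num)
  have hYint : Integrable (fun ω => (Z ω - m) ^ 2) μ := (hZ2.sub (memLp_const m)).integrable_sq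
  obtain ⟨t₀, ht₀1, ht₀⟩ := hb.exists_mul_rpow_div_le hr1 (show 0 < δ / 4 by linarith)
  obtain ⟨y₀, hy₀⟩ := exists_nat_ge t₀
  set C := Real.exp (y₀ + 1 + |m|) with hC
  refine ⟨C * ∫ ω, ((Z ω - m) ^ 2 + H ⌊Z ω⌋₊) ∂μ,
    mul_nonneg (Real.exp_pos _).le (integral_nonneg fun ω => add_nonneg (sq_nonneg _) (hH0 _)), ?_⟩
  filter_upwards [(hb.tendsto_mul_rpow_div_zero hr1).eventually (gt_mem_nhds zero_lt_one),
    eventually_ge_atTop m, eventually_ge_atTop 1] with T hT1 hTm hT w hw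
  have hT0 : 0 < T := by linarith
  have := hb.pos T hT0
  have hq : 0 < b T * T ^ r / T := by positivity
  set s := (1 - δ) * (b T * T ^ r / T) with hs
  have hs0 : 0 ≤ s := mul_nonneg (by linarith) hq.le
  have hs1 : s ≤ 1 := by nlinarith
  -- Below `y₀` the exponential is bounded by `C` since `s w ≤ 1`; above it the comparison is made
  -- at the integer part of `z`, the remainder going into `C`.
  have hdom : ∀ z < T, (z - m) ^ 2 * Real.exp (max (s * (w * (z - m))) 0) ≤
      C * ((z - m) ^ 2 + H ⌊z⌋₊) := by
    intro z hz
    rcases lt_or_ge z y₀ with hzy | hzy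
    · have h1 : Real.exp (max (s * (w * (z - m))) 0) ≤ C := by
        rw [hC]
        gcongr
        refine max_le ?_ (by positivity)
        rw [← mul_assoc]
        have h2 : s * w ≤ 1 := mul_le_one₀ hs1 hw.1 hw.2
        have h3 : 0 ≤ s * w := mul_nonneg hs0 hw.1
        have h4 : z - m ≤ y₀ + 1 + |m| := by linarith [neg_abs_le m]
        have h5 : (0 : ℝ) ≤ y₀ + 1 + |m| := by positivity
        nlinarith
      nlinarith [hH0 ⌊z⌋₊, sq_nonneg (z - m), Real.exp_pos (y₀ + 1 + |m| : ℝ)]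
    · have hz1 : 1 ≤ z := by linarith
      have hk1 : (⌊z⌋₊ : ℝ) ≤ z := Nat.floor_le (by linarith)
      have hk2 : z < ⌊z⌋₊ + 1 := Nat.lt_floor_add_one z
      have hk3 : (y₀ : ℝ) ≤ ⌊z⌋₊ := by exact_mod_cast Nat.le_floor hzy
      set k := ⌊z⌋₊
      have hk0 : (0 : ℝ) < k := by linarith
      have h1 := ht₀ k (by linarith) T (by linarith)
      have h2 : s * k ≤ (1 - δ) * (1 + δ / 4) * (b k * (k : ℝ) ^ r) := by
        rw [hs]
        calc (1 - δ) * (b T * T ^ r / T) * k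
            ≤ (1 - δ) * ((1 + δ / 4) * (b k * (k : ℝ) ^ r / k)) * k := by
              have : 0 ≤ 1 - δ := by linarith
              gcongr
          _ = _ := by field_simp
      have hbk := hb.pos k hk0
      have hexp : max (s * (w * (z - m))) 0 ≤
          (y₀ + 1 + |m|) + (1 - δ) * (1 + δ / 4) * (b k * (k : ℝ) ^ r) := by
        have h0 : 0 ≤ s * k := by positivity
        refine max_le ?_ (add_nonneg (by positivity) (h0.trans h2))
        have h4 : w * (z - m) ≤ k + (1 + |m|) := by
          have h5 : z - m ≤ k + (1 + |m|) := by linarith [neg_abs_le m]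
          have h6 : (0 : ℝ) ≤ k + (1 + |m|) := by positivity
          nlinarith [hw.1, hw.2]
        have h7 : s * (1 + |m|) ≤ 1 + |m| := mul_le_of_le_one_left (by positivity) hs1
        have h8 := mul_le_mul_of_nonneg_left h4 hs0
        have : (0 : ℝ) ≤ y₀ := by positivity
        nlinarith
      have hsq : (z - m) ^ 2 ≤ ((k : ℝ) + 1 + |m|) ^ 2 := by
        refine sq_le_sq' ?_ ?_
        · linarith [le_abs_self m]
        · linarith [neg_abs_le m]
      calc (z - m) ^ 2 * Real.exp (max (s * (w * (z - m))) 0)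
          ≤ ((k : ℝ) + 1 + |m|) ^ 2 * (C * Real.exp ((1 - δ) * (1 + δ / 4) *
              (b k * (k : ℝ) ^ r))) := by
            rw [hC, ← Real.exp_add]
            gcongr
        _ = C * H k := by rw [hH]; ring
        _ ≤ _ := by
          have : 0 ≤ C := (Real.exp_pos _).le
          gcongr
          linarith [sq_nonneg (z - m)]
  -- The bound persists for `z ≥ T`, where the left side vanishes, because `T ≥ m` keeps the linear
  -- term nonnegative.
  have hpt : ∀ z, (Set.Iio T).indicator (fun z => Real.exp (s * (w * (z - m)))) z ≤
      1 + s * w * (z - m) + s ^ 2 * C * ((z - m) ^ 2 + H ⌊z⌋₊) := by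
    intro z
    have hC0 : 0 ≤ C := (Real.exp_pos _).le
    have hsw : 0 ≤ s * w := mul_nonneg hs0 hw.1
    by_cases hz : z < T
    · rw [Set.indicator_of_mem (show z ∈ Set.Iio T from hz)]
      have h1 := Real.exp_le_one_add_add_sq_mul_exp (s * (w * (z - m)))
      have h2 := mul_le_mul_of_nonneg_left (hdom z hz) (sq_nonneg s)
      have h3 : (s * (w * (z - m))) ^ 2 * Real.exp (max (s * (w * (z - m))) 0) ≤
          s ^ 2 * ((z - m) ^ 2 * Real.exp (max (s * (w * (z - m))) 0)) := by
        have hw2 : w ^ 2 ≤ 1 := pow_le_one₀ hw.1 hw.2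
        have h5 : 0 ≤ s ^ 2 * ((z - m) ^ 2 * Real.exp (max (s * (w * (z - m))) 0)) := by
          positivity
        calc _ = w ^ 2 * (s ^ 2 * ((z - m) ^ 2 * Real.exp (max (s * (w * (z - m))) 0))) := by ring
          _ ≤ _ := mul_le_of_le_one_left h5 hw2
      linarith
    · rw [Set.indicator_of_notMem (by simpa using hz)]
      push Not at hz
      have h1 : 0 ≤ s * w * (z - m) := mul_nonneg hsw (by linarith)
      have h2 : 0 ≤ s ^ 2 * C * ((z - m) ^ 2 + H ⌊z⌋₊) :=
        mul_nonneg (by positivity) (add_nonneg (sq_nonneg _) (hH0 _))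
      linarith
  have hi1 : Integrable (fun ω => s * w * (Z ω - m)) μ :=
    (hZint.sub (integrable_const m)).const_mul _
  have hi2 : Integrable (fun ω => s ^ 2 * C * ((Z ω - m) ^ 2 + H ⌊Z ω⌋₊)) μ :=
    (hYint.add hHint).const_mul _
  have hmean : ∫ ω, (Z ω - m) ∂μ = 0 := by
    rw [integral_sub hZint (integrable_const m)]
    simp [hm]
  calc _ ≤ ∫ ω, (1 + s * w * (Z ω - m) + s ^ 2 * C * ((Z ω - m) ^ 2 + H ⌊Z ω⌋₊)) ∂μ := by
        refine integral_mono_of_nonneg (ae_of_all _ fun ω => ?_)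
          (((integrable_const 1).add hi1).add hi2) (ae_of_all _ fun ω => hpt (Z ω))
        exact Set.indicator_nonneg (fun _ _ => (Real.exp_pos _).le) _
    _ = _ := by
      rw [integral_add (f := fun ω => 1 + s * w * (Z ω - m)) ((integrable_const 1).add hi1) hi2,
        integral_add (integrable_const 1) hi1,
        integral_const_mul, integral_const_mul, hmean]
      simp
      ring

end TruncatedExponentialMoment

/-- Chernoff bound for weighted sums of truncated i.i.d. random variables. -/
theorem measureReal_truncated_weighted_sum_ge_le {Ω : Type*} [MeasurableSpace Ω] {μ : Measure Ω}
    [IsProbabilityMeasure μ] {X : ℕ → Ω → ℝ} (hX : ∀ j, Measurable (X j))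
    (hind : iIndepFun X μ) (hid : ∀ j, IdentDistrib (X j) (X 0) μ μ) {m s T u B : ℝ} (hs : 0 ≤ s)
    (hB : ∀ w ∈ Set.Icc (0 : ℝ) 1, ∫ ω, (Set.Iio T).indicator
      (fun z => Real.exp (s * (w * (z - m)))) (X 0 ω) ∂μ ≤ B)
    {n : ℕ} {w : ℕ → ℝ} (hw : ∀ j < n, w j ∈ Set.Icc (0 : ℝ) 1) :
    μ.real {ω | u ≤ ∑ j ∈ Finset.range n, w j * (X j ω - m) ∧ ∀ j < n, X j ω < T} ≤
      Real.exp (-(s * u)) * B ^ n := by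
  -- Putting the truncation into each factor keeps the product bounded, hence integrable, and still
  -- a product of independent terms.
  set g : Fin n → ℝ → ℝ := fun j => (Set.Iio T).indicator
      (fun z => Real.exp (s * (w j * (z - m)))) with hg
  have hgm : ∀ j, Measurable (g j) := fun j => by
    refine Measurable.indicator ?_ measurableSet_Iio
    fun_prop
  have hg0 : ∀ j z, 0 ≤ g j z := fun j z =>
    Set.indicator_nonneg (fun _ _ => (Real.exp_pos _).le) _
  have hgb : ∀ j z, g j z ≤ Real.exp (s * (w j * (T - m))) := by
    intro j z
    simp only [hg]
    refine Set.indicator_apply_le' (fun hz => ?_) (fun _ => (Real.exp_pos _).le)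
    have h1 := (hw j j.2).1
    have h2 : z ≤ T := le_of_lt hz
    gcongr
  have hprod : ∫ ω, ∏ j : Fin n, g j (X j ω) ∂μ = ∏ j : Fin n, ∫ ω, g j (X j ω) ∂μ :=
    iIndepFun.integral_fun_prod_comp (hind.precomp Fin.val_injective)
      (fun j => (hX j).aemeasurable) (fun j => (hgm j).aestronglyMeasurable)
  have hle : ∫ ω, ∏ j : Fin n, g j (X j ω) ∂μ ≤ B ^ n := by
    rw [hprod]
    calc ∏ j : Fin n, ∫ ω, g j (X j ω) ∂μ ≤ ∏ j : Fin n, B := by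
          refine Finset.prod_le_prod (fun j _ => integral_nonneg fun ω => hg0 _ _) fun j _ => ?_
          exact (((hid j).comp (hgm j)).integral_eq).trans_le (hB _ (hw j j.2))
      _ = B ^ n := by simp
  have hint : Integrable (fun ω => ∏ j : Fin n, g j (X j ω)) μ := by
    refine Integrable.of_bound (C := ∏ j : Fin n, Real.exp (s * (w j * (T - m)))) ?_ ?_
    · exact (Finset.measurable_prod _ fun j _ => (hgm j).comp (hX j)).aestronglyMeasurable
    · refine ae_of_all _ fun ω => ?_
      rw [Real.norm_of_nonneg (Finset.prod_nonneg fun j _ => hg0 _ _)]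
      exact Finset.prod_le_prod (fun j _ => hg0 _ _) fun j _ => hgb _ _
  have hmarkov := mul_meas_ge_le_integral_of_nonneg (μ := μ)
    (ae_of_all _ fun ω => Finset.prod_nonneg fun j _ => hg0 j (X j ω)) hint (Real.exp (s * u))
  have hsub : {ω | u ≤ ∑ j ∈ Finset.range n, w j * (X j ω - m) ∧ ∀ j < n, X j ω < T} ⊆
      {ω | Real.exp (s * u) ≤ ∏ j : Fin n, g j (X j ω)} := by
    rintro ω ⟨h1, h2⟩
    have h3 : ∏ j : Fin n, g j (X j ω) =
        Real.exp (s * ∑ j ∈ Finset.range n, w j * (X j ω - m)) := by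
      rw [Finset.mul_sum, Real.exp_sum, ← Fin.prod_univ_eq_prod_range
        (fun j => Real.exp (s * (w j * (X j ω - m))))]
      refine Finset.prod_congr rfl fun j _ => ?_
      simp only [hg]
      rw [Set.indicator_of_mem (show X j ω ∈ Set.Iio T from h2 j j.2)]
    simp only [Set.mem_ofPred_eq]
    rw [h3]
    gcongr
  rw [Real.exp_neg, inv_mul_eq_div, le_div_iff₀' (Real.exp_pos _)]
  exact (mul_le_mul_of_nonneg_left (measureReal_mono hsub) (Real.exp_pos _).le).trans
    (hmarkov.trans hle)

theorem measureReal_le_eq_of_identDistrib {Ω : Type*} [MeasurableSpace Ω] {μ : Measure Ω}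
    {X : ℕ → Ω → ℝ} (hid : ∀ j, IdentDistrib (X j) (X 0) μ μ) (j : ℕ)
    (t : ℝ) : μ.real {ω | t ≤ X j ω} = μ.real {ω | t ≤ X 0 ω} := by
  have := (hid j).measure_mem_eq (s := Set.Ici t) measurableSet_Ici
  simp only [measureReal_def]
  exact congrArg ENNReal.toReal this

/-! ### Upper and lower bounds uniform in deterministic weights. -/

section DeterministicWeights

variable {Ω : Type*} [MeasurableSpace Ω] {μ : Measure Ω} [IsProbabilityMeasure μ] {X : ℕ → Ω → ℝ}
  {b : ℝ → ℝ} {r : ℝ}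

theorem eventually_measureReal_weighted_sum_le (hX : ∀ j, Measurable (X j))
    (hind : iIndepFun X μ) (hid : ∀ j, IdentDistrib (X j) (X 0) μ μ) (hX2 : MemLp (X 0) 2 μ)
    (hr0 : 0 < r) (hr1 : r < 1) (hb : SlowlyVarying b)
    (hpos : ∀ᶠ t in atTop, 0 < μ.real {ω | t ≤ X 0 ω})
    (hF : Tendsto (fun t => Real.log (μ.real {ω | t ≤ X 0 ω}) / (b t * t ^ r)) atTop (𝓝 (-1)))
    {x c M K : ℝ} (hx : ∫ ω, X 0 ω ∂μ < x) (hc : 0 < c) (hM : 0 < M)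
    (hK : K < (c * (x - ∫ ω, X 0 ω ∂μ) / M) ^ r) :
    ∀ᶠ n : ℕ in atTop, ∀ t : ℕ → ℝ, (∀ j, 0 ≤ t j ∧ t j ≤ M) →
      n * c ≤ ∑ i ∈ Finset.range n, t i →
      μ.real {ω | x ≤ ∑ j ∈ Finset.range n, t j / (∑ i ∈ Finset.range n, t i) * X j ω} ≤
        Real.exp (-K * (b n * (n : ℝ) ^ r)) := by
  set m := ∫ ω, X 0 ω ∂μ with hm
  -- Scaling the weights by `n c / M` brings them into `[0, 1]` and turns the deviation `x - m` into
  -- `τ n`, so the same level serves for truncation and for deviation.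
  set τ := c * (x - m) / M with hτ
  have hxm : 0 < x - m := by linarith
  have hτ0 : 0 < τ := by positivity
  obtain ⟨δ, hKδ, hδ1, hδ0⟩ : ∃ δ : ℝ, K < (1 - δ) * τ ^ r ∧ δ < 1 ∧ 0 < δ := by
    have h1 : Tendsto (fun δ : ℝ => (1 - δ) * τ ^ r) (𝓝[>] 0) (𝓝 ((1 - 0) * τ ^ r)) :=
      (Continuous.tendsto (by fun_prop) _).mono_left nhdsWithin_le_nhds
    have h2 := h1.eventually (lt_mem_nhds (by simpa using hK))
    exact (h2.and ((eventually_nhdsWithin_of_eventually_nhds (gt_mem_nhds zero_lt_one)).and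
      self_mem_nhdsWithin)).exists
  obtain ⟨D, hD0, hD⟩ := exists_truncated_exponential_moment_le (hX 0) hX2 hr0 hr1 hb hpos hF
    hδ0 hδ1
  have hτt : Tendsto (fun t : ℝ => τ * t) atTop atTop := tendsto_id.const_mul_atTop hτ0
  -- The gain `s T` is `(1 - δ) b(τ t) (τ t)^r`, asymptotically `(1 - δ) τ^r b(t) t^r`; the loss `t
  -- s² D` is smaller by the factor `(1 - δ) (D / τ) b(T) T^r / T`, which tends to 0.
  have hexp : ∀ᶠ t : ℝ in atTop,
      2 * Real.exp (-((1 - δ) * (b (τ * t) * (τ * t) ^ r / (τ * t)) * (τ * t)) +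
        t * (((1 - δ) * (b (τ * t) * (τ * t) ^ r / (τ * t))) ^ 2 * D)) ≤
        Real.exp (-K * (b t * t ^ r)) := by
    have h1 := hb.tendsto_mul_rpow_comp_mul_div (r := r) hτ0
    have h2 := (hb.tendsto_mul_rpow_div_zero hr1).comp hτt
    have h3 : Tendsto (fun t => Real.log 2 / (b t * t ^ r)) atTop (𝓝 0) :=
      (hb.tendsto_mul_rpow_atTop hr0).const_div_atTop _
    have h4 := ((h1.const_mul (1 - δ)).mul ((h2.const_mul ((1 - δ) * D / τ)).const_sub 1)).sub h3
    have h5 := h4.eventually (lt_mem_nhds (a := K) (by simpa using hKδ))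
    filter_upwards [h5, eventually_gt_atTop 0] with t h6 ht
    have hbt := hb.pos t ht
    have hφ : 0 < b t * t ^ r := by positivity
    have h7 : (1 - δ) * (b (τ * t) * (τ * t) ^ r / (b t * t ^ r)) *
        (1 - (1 - δ) * D / τ * (b (τ * t) * (τ * t) ^ r / (τ * t))) - Real.log 2 / (b t * t ^ r)
        = ((1 - δ) * (b (τ * t) * (τ * t) ^ r / (τ * t)) * (τ * t) -
        t * (((1 - δ) * (b (τ * t) * (τ * t) ^ r / (τ * t))) ^ 2 * D) - Real.log 2) /
          (b t * t ^ r) := by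
      generalize b (τ * t) * (τ * t) ^ r = φ
      field_simp
    simp only [Function.comp] at h6
    rw [h7, lt_div_iff₀ hφ] at h6
    rw [← Real.log_le_log_iff (by positivity) (Real.exp_pos _),
      Real.log_mul (by norm_num) (Real.exp_pos _).ne', Real.log_exp, Real.log_exp]
    linarith
  have htail := eventually_two_mul_mul_le_exp hr0 hb hpos hF hτ0 hK
  filter_upwards [tendsto_natCast_atTop_atTop.eventually hexp,
    tendsto_natCast_atTop_atTop.eventually htail,
    (hτt.comp tendsto_natCast_atTop_atTop).eventually hD, eventually_ge_atTop 1]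
    with n h1 h2 h3 hn t ht hS
  have hn0 : (0 : ℝ) < n := by exact_mod_cast hn
  simp only [Function.comp] at h3
  set T := τ * (n : ℝ) with hT
  have hT0 : 0 < T := by positivity
  set s := (1 - δ) * (b T * T ^ r / T) with hs
  have hbT := hb.pos T hT0
  have hs0 : 0 ≤ s := mul_nonneg (by linarith) (by positivity)
  set S := ∑ i ∈ Finset.range n, t i with hSdef
  have hS0 : 0 < S := lt_of_lt_of_le (by positivity) hS
  have hw : ∀ j < n, (n * c / M) * (t j / S) ∈ Set.Icc (0 : ℝ) 1 := by
    intro j _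
    refine ⟨mul_nonneg (by positivity) (div_nonneg (ht j).1 hS0.le), ?_⟩
    rw [div_mul_div_comm, div_le_one (by positivity), mul_comm M S]
    exact mul_le_mul hS (ht j).2 (ht j).1 hS0.le
  have hch := measureReal_truncated_weighted_sum_ge_le hX hind hid (u := T) hs0 h3 hw
  have hsub : {ω | x ≤ ∑ j ∈ Finset.range n, t j / S * X j ω} ⊆
      (⋃ j ∈ Finset.range n, {ω | T ≤ X j ω}) ∪
      {ω | T ≤ ∑ j ∈ Finset.range n, (n * c / M) * (t j / S) * (X j ω - m) ∧
        ∀ j < n, X j ω < T} := by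
    intro ω hω
    by_cases hmax : ∃ j < n, T ≤ X j ω
    · obtain ⟨j, hj, hjT⟩ := hmax
      left
      simp only [Set.mem_iUnion, Finset.mem_range]
      exact ⟨j, hj, hjT⟩
    · right
      push Not at hmax
      refine ⟨?_, hmax⟩
      have hsum : ∑ j ∈ Finset.range n, (n * c / M) * (t j / S) * (X j ω - m) =
          (n * c / M) * (∑ j ∈ Finset.range n, t j / S * X j ω - m) := by
        have h5 : ∑ j ∈ Finset.range n, t j / S = 1 := by
          rw [← Finset.sum_div, div_self hS0.ne']
        calc _ = (n * c / M) * (∑ j ∈ Finset.range n, t j / S * X j ω -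
              (∑ j ∈ Finset.range n, t j / S) * m) := by
              rw [Finset.sum_mul, ← Finset.sum_sub_distrib, Finset.mul_sum]
              exact Finset.sum_congr rfl fun j _ => by ring
          _ = _ := by rw [h5, one_mul]
      rw [hsum, hT, hτ, show c * (x - m) / M * n = n * c / M * (x - m) by ring]
      have h6 : x ≤ ∑ j ∈ Finset.range n, t j / S * X j ω := hω
      gcongr
  have hpow : Real.exp (-(s * T)) * (1 + s ^ 2 * D) ^ n ≤
      Real.exp (-(s * T) + n * (s ^ 2 * D)) := by
    rw [Real.exp_add, Real.exp_nat_mul]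
    have h5 : 1 + s ^ 2 * D ≤ Real.exp (s ^ 2 * D) := by
      linarith [Real.add_one_le_exp (s ^ 2 * D)]
    have h6 : 0 ≤ 1 + s ^ 2 * D := by positivity
    gcongr
  have hunion : μ.real (⋃ j ∈ Finset.range n, {ω | T ≤ X j ω}) ≤ n * μ.real {ω | T ≤ X 0 ω} := by
    refine (measureReal_biUnion_finset_le _ _).trans (le_of_eq ?_)
    rw [Finset.sum_congr rfl fun j _ => measureReal_le_eq_of_identDistrib hid j T]
    simp
  have := (measureReal_mono hsub (μ := μ)).trans (measureReal_union_le _ _)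
  linarith

/-- Chebyshev's inequality, with `∑ a_i² ≤ α ∑ a_i ≤ α`: small individual weights force a small
variance. -/
theorem half_le_measureReal_weighted_sum_ge (hind : iIndepFun X μ)
    (hid : ∀ j, IdentDistrib (X j) (X 0) μ μ) (hX2 : MemLp (X 0) 2 μ) (s : Finset ℕ) {a : ℕ → ℝ}
    {α η v : ℝ} (ha : ∀ i ∈ s, 0 ≤ a i ∧ a i ≤ α) (hsum : ∑ i ∈ s, a i ≤ 1) (hη : 0 < η)
    (hα : 2 * (Var[X 0; μ] * α) ≤ η ^ 2) (hα0 : 0 ≤ α)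
    (hv : v + η ≤ (∑ i ∈ s, a i) * ∫ ω, X 0 ω ∂μ) :
    1 / 2 ≤ μ.real {ω | v ≤ (∑ i ∈ s, fun ω => a i * X i ω) ω} := by
  have hXi : ∀ i, MemLp (X i) 2 μ := fun i => (hid i).memLp_iff.2 hX2
  have hL : ∀ i ∈ s, MemLp (fun ω => a i * X i ω) 2 μ := fun i _ => (hXi i).const_mul _
  set R : Ω → ℝ := ∑ i ∈ s, fun ω => a i * X i ω with hR
  have hRL : MemLp R 2 μ := memLp_finsetSum' _ hL
  have hmean : ∫ ω, R ω ∂μ = (∑ i ∈ s, a i) * ∫ ω, X 0 ω ∂μ := by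
    simp only [hR, Finset.sum_apply]
    rw [integral_finsetSum _ fun i hi => (hL i hi).integrable (by norm_num), Finset.sum_mul]
    refine Finset.sum_congr rfl fun i _ => ?_
    rw [integral_const_mul, (hid i).integral_eq]
  have hvar : Var[R; μ] ≤ Var[X 0; μ] * α := by
    rw [hR, IndepFun.variance_sum hL]
    · calc ∑ i ∈ s, Var[fun ω => a i * X i ω; μ] = ∑ i ∈ s, a i ^ 2 * Var[X 0; μ] := by
            refine Finset.sum_congr rfl fun i _ => ?_
            rw [variance_const_mul, (hid i).variance_eq]
        _ ≤ ∑ i ∈ s, a i * (α * Var[X 0; μ]) := by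
            refine Finset.sum_le_sum fun i hi => ?_
            have h1 := variance_nonneg (X 0) μ
            have h2 := ha i hi
            rw [← mul_assoc, sq]
            gcongr
            · exact h2.1
            · exact h2.2
        _ = (∑ i ∈ s, a i) * (α * Var[X 0; μ]) := by rw [Finset.sum_mul]
        _ ≤ 1 * (α * Var[X 0; μ]) := by
            have h1 := variance_nonneg (X 0) μ
            gcongr
        _ = _ := by ring
    · intro i _ j _ hij
      exact (hind.indepFun hij).comp (measurable_const_mul (a i)) (measurable_const_mul (a j))
  have hcheb := meas_ge_le_variance_div_sq hRL hη
  have hcheb' : μ.real {ω | η ≤ |R ω - ∫ ω, R ω ∂μ|} ≤ 1 / 2 := by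
    rw [measureReal_def]
    refine ENNReal.toReal_le_of_le_ofReal (by norm_num) (hcheb.trans ?_)
    refine ENNReal.ofReal_le_ofReal ?_
    rw [div_le_div_iff₀ (by positivity) (by norm_num)]
    linarith
  have hcover : (Set.univ : Set Ω) ⊆ {ω | v ≤ R ω} ∪ {ω | η ≤ |R ω - ∫ ω, R ω ∂μ|} := by
    intro ω _
    by_contra hcon
    simp only [Set.mem_union, Set.mem_ofPred_eq, not_or, not_le, hmean] at hcon
    have := neg_abs_le (R ω - (∑ i ∈ s, a i) * ∫ ω, X 0 ω ∂μ)
    linarith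
  have h1 := (measureReal_mono hcover (μ := μ)).trans (measureReal_union_le _ _)
  rw [probReal_univ] at h1
  linarith

theorem eventually_le_measureReal_weighted_sum (hX : ∀ j, Measurable (X j))
    (hind : iIndepFun X μ) (hid : ∀ j, IdentDistrib (X j) (X 0) μ μ) (hX2 : MemLp (X 0) 2 μ)
    (hr0 : 0 < r) (hb : SlowlyVarying b)
    (hpos : ∀ᶠ t in atTop, 0 < μ.real {ω | t ≤ X 0 ω})
    (hF : Tendsto (fun t => Real.log (μ.real {ω | t ≤ X 0 ω}) / (b t * t ^ r)) atTop (𝓝 (-1)))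
    {x c C M M' K : ℝ} (hx : ∫ ω, X 0 ω ∂μ < x) (hc : 0 < c) (hC : 0 < C) (hM : 0 < M)
    (hM' : 0 < M') (hK : (C * (x - ∫ ω, X 0 ω ∂μ) / M') ^ r < K) :
    ∀ᶠ n : ℕ in atTop, ∀ t : ℕ → ℝ, (∀ j, 0 ≤ t j ∧ t j ≤ M) →
      n * c ≤ ∑ i ∈ Finset.range n, t i → ∑ i ∈ Finset.range n, t i ≤ n * C →
      (∃ j < n, M' ≤ t j) →
      Real.exp (-K * (b n * (n : ℝ) ^ r)) ≤
      μ.real {ω | x ≤ ∑ j ∈ Finset.range n, t j / (∑ i ∈ Finset.range n, t i) * X j ω} := by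
  set m := ∫ ω, X 0 ω ∂μ with hm
  have hxm : 0 < x - m := by linarith
  obtain ⟨δ, hKδ, hδ0⟩ : ∃ δ : ℝ, (C * (x - m + δ) / M') ^ r < K ∧ 0 < δ := by
    have h1 : Tendsto (fun δ : ℝ => (C * (x - m + δ) / M') ^ r) (𝓝[>] 0)
        (𝓝 ((C * (x - m + 0) / M') ^ r)) := by
      refine Tendsto.rpow_const ?_ (Or.inr hr0.le)
      exact (Continuous.tendsto (by fun_prop) _).mono_left nhdsWithin_le_nhds
    have h2 := h1.eventually (gt_mem_nhds (by simpa using hK))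
    exact (h2.and self_mem_nhdsWithin).exists
  have hδ : 0 < x - m + δ := by linarith
  -- The jump size for which the least possible weight `M' / (n C)` of the chosen index contributes
  -- exactly `x - m + δ`; the other terms then need only reach `m - δ`.
  set κ := C * (x - m + δ) / M' with hκ
  have hκ0 : 0 < κ := by positivity
  have hα : Tendsto (fun n : ℕ => M / (n * c)) atTop (𝓝 0) :=
    (tendsto_natCast_atTop_atTop.atTop_mul_const hc).const_div_atTop M
  have hv0 : ∀ᶠ n : ℕ in atTop, 2 * (Var[X 0; μ] * (M / (n * c))) < (δ / 2) ^ 2 := by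
    have := (hα.const_mul (Var[X 0; μ])).const_mul 2
    exact this.eventually (gt_mem_nhds (by simp; positivity))
  have hm0 : ∀ᶠ n : ℕ in atTop, M / (n * c) * |m| < δ / 2 :=
    (hα.mul_const |m|).eventually (gt_mem_nhds (by simp; positivity))
  filter_upwards [tendsto_natCast_atTop_atTop.eventually
    (eventually_two_mul_exp_le hr0 hb hpos hF hκ0 hKδ), hv0, hm0, eventually_ge_atTop 1]
    with n h1 h2 h3 hn t ht hS hSC hj
  obtain ⟨j, hjn, hjM⟩ := hj
  have hn0 : (0 : ℝ) < n := by exact_mod_cast hn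
  set S := ∑ i ∈ Finset.range n, t i with hSdef
  have hS0 : 0 < S := lt_of_lt_of_le (by positivity) hS
  have hai : ∀ i, 0 ≤ t i / S ∧ t i / S ≤ M / (n * c) := fun i =>
    ⟨div_nonneg (ht i).1 hS0.le, div_le_div₀ hM.le (ht i).2 (by positivity) hS⟩
  have hsum1 : ∑ i ∈ Finset.range n, t i / S = 1 := by
    rw [← Finset.sum_div, div_self hS0.ne']
  have hjmem : j ∈ Finset.range n := Finset.mem_range.2 hjn
  have hsplit := Finset.add_sum_erase (Finset.range n) (fun i => t i / S) hjmem
  rw [hsum1] at hsplit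
  have haj : 0 < t j / S := div_pos (hM'.trans_le hjM) hS0
  set R : Ω → ℝ := ∑ i ∈ (Finset.range n).erase j, fun ω => t i / S * X i ω with hR
  have hhalf : 1 / 2 ≤ μ.real {ω | m - δ ≤ R ω} := by
    refine half_le_measureReal_weighted_sum_ge hind hid hX2 ((Finset.range n).erase j)
      (a := fun i => t i / S) (fun i _ => hai i) (by linarith) (half_pos hδ0) h2.le
      (by positivity) ?_
    -- Deleting the index `j` shifts the mean by less than `δ/2`; the other `δ/2` is the Chebyshev
    -- deviation.
    rw [show ∑ i ∈ (Finset.range n).erase j, t i / S = 1 - t j / S by linarith]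
    have h4 : t j / S * m ≤ M / (n * c) * |m| :=
      (mul_le_mul_of_nonneg_left (le_abs_self m) haj.le).trans
        (mul_le_mul_of_nonneg_right (hai j).2 (abs_nonneg m))
    linarith
  have hindep : IndepFun R (fun ω => t j / S * X j ω) μ := by
    have h4 : iIndepFun (fun i ω => t i / S * X i ω) μ :=
      hind.comp (fun i z => t i / S * z) fun i => measurable_const_mul _
    exact h4.indepFun_finsetSum_of_notMem (fun i => (hX i).const_mul _)
      (Finset.notMem_erase j _)
  have hprod := hindep.measure_inter_preimage_eq_mul (Set.Ici (m - δ))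
    (Set.Ici (t j / S * (κ * n))) measurableSet_Ici measurableSet_Ici
  have hprod' : μ.real ({ω | m - δ ≤ R ω} ∩ {ω | κ * n ≤ X j ω}) =
      μ.real {ω | m - δ ≤ R ω} * μ.real {ω | κ * n ≤ X j ω} := by
    have h4 : (fun ω => t j / S * X j ω) ⁻¹' (Set.Ici (t j / S * (κ * n))) =
        {ω | κ * n ≤ X j ω} := by
      ext ω
      simp only [Set.mem_preimage, Set.mem_Ici, Set.mem_ofPred_eq]
      exact mul_le_mul_iff_right₀ haj
    rw [h4] at hprod
    simp only [measureReal_def]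
    rw [← ENNReal.toReal_mul]
    exact congrArg ENNReal.toReal hprod
  have hsub : {ω | m - δ ≤ R ω} ∩ {ω | κ * n ≤ X j ω} ⊆
      {ω | x ≤ ∑ j ∈ Finset.range n, t j / S * X j ω} := by
    rintro ω ⟨h4, h5⟩
    simp only [Set.mem_ofPred_eq, hR, Finset.sum_apply] at h4 h5 ⊢
    rw [← Finset.add_sum_erase _ _ hjmem]
    have h6 : x - m + δ ≤ t j / S * X j ω := by
      calc x - m + δ = M' / (n * C) * (κ * n) := by rw [hκ]; field_simp
        _ ≤ t j / S * X j ω := by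
          have : 0 ≤ t j / S := haj.le
          have h7 : M' / (n * C) ≤ t j / S := div_le_div₀ (ht j).1 hjM hS0 hSC
          gcongr
    linarith
  have h4 := measureReal_mono hsub (μ := μ)
  rw [hprod', measureReal_le_eq_of_identDistrib hid j] at h4
  refine le_trans ?_ h4
  have h5 : 0 ≤ μ.real {ω | κ * n ≤ X 0 ω} := measureReal_nonneg
  nlinarith

end DeterministicWeights

/-! ### Conditioning, and passage from exponential bounds to the limit. -/

/-- Freezing lemma: conditioning an event that depends on two independent variables on the second
of them. -/
theorem condExp_comap_indicator_ae_eq_of_indepFun {Ω α β : Type*} [MeasurableSpace Ω]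
    [MeasurableSpace α] [mβ : MeasurableSpace β] {μ : Measure Ω} [IsProbabilityMeasure μ] {U : Ω → α}
    {V : Ω → β} (hU : Measurable U) (hV : Measurable V) (hUV : IndepFun U V μ) {A : Set (α × β)}
    (hA : MeasurableSet A) :
    μ⟦{ω | (U ω, V ω) ∈ A} | mβ.comap V⟧ =ᵐ[μ] fun ω => μ.real {ω' | (U ω', V ω) ∈ A} := by
  set G : β → ENNReal := fun v => μ.map U ((fun u => (u, v)) ⁻¹' A) with hG
  have hGm : Measurable G := measurable_measure_prodMk_right hA
  have hGle : ∀ v, G v ≤ 1 := fun v => by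
    have : IsProbabilityMeasure (μ.map U) := Measure.isProbabilityMeasure_map hU.aemeasurable
    exact prob_le_one
  have hreal : (fun ω => μ.real {ω' | (U ω', V ω) ∈ A}) = fun ω => (G (V ω)).toReal := by
    ext ω
    rw [measureReal_def, hG]
    simp only
    rw [Measure.map_apply hU (measurable_prodMk_right hA)]
    rfl
  rw [hreal]
  have hEm : MeasurableSet {ω | (U ω, V ω) ∈ A} := (hU.prodMk hV) hA
  have hint : Integrable (fun ω => (G (V ω)).toReal) μ := by
    refine Integrable.of_bound (C := 1) (hGm.comp hV).ennreal_toReal.aestronglyMeasurable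
      (ae_of_all _ fun ω => ?_)
    rw [Real.norm_of_nonneg ENNReal.toReal_nonneg]
    exact ENNReal.toReal_le_of_le_ofReal zero_le_one (by simpa using hGle (V ω))
  refine (ae_eq_condExp_of_forall_setIntegral_eq hV.comap_le ?_ ?_ ?_ ?_).symm
  · exact (integrable_const 1).indicator hEm
  · exact fun s _ _ => hint.integrableOn
  · rintro s ⟨B, hB, rfl⟩ -
    rw [integral_toReal (f := fun ω => G (V ω)) (hGm.comp hV).aemeasurable
      (ae_of_all _ fun ω => (hGle _).trans_lt ENNReal.one_lt_top),
      ← setLIntegral_map hB hGm hV, integral_indicator hEm, setIntegral_const, smul_eq_mul, mul_one,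
      measureReal_def]
    congr 1
    -- Both integrals over `V ⁻¹' B` equal the product measure of `A ∩ (α × B)`: one by Fubini, the
    -- other by independence.
    have hAB : MeasurableSet (A ∩ Prod.snd ⁻¹' B) := hA.inter (measurable_snd hB)
    have h1 : ((μ.map U).prod (μ.map V)) (A ∩ Prod.snd ⁻¹' B) = ∫⁻ v in B, G v ∂μ.map V := by
      rw [Measure.prod_apply_symm hAB, ← lintegral_indicator hB]
      refine lintegral_congr fun v => ?_
      by_cases hv : v ∈ B
      · rw [Set.indicator_of_mem hv, hG]
        simp only
        congr 1
        ext u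
        simp [hv]
      · rw [Set.indicator_of_notMem hv]
        have : (fun u : α => (u, v)) ⁻¹' (A ∩ Prod.snd ⁻¹' B) = ∅ := by
          ext u
          simp [hv]
        rw [this, measure_empty]
    rw [← h1, ← (indepFun_iff_map_prod_eq_prod_map_map hU.aemeasurable hV.aemeasurable).1 hUV,
      Measure.map_apply (hU.prodMk hV) hAB, Measure.restrict_apply hEm]
    rfl
  · refine StronglyMeasurable.aestronglyMeasurable ?_
    have h1 : Measurable[mβ.comap V] V := comap_measurable V
    exact (hGm.ennreal_toReal.comp h1).stronglyMeasurable

/-- Upper bounds at positive `K` suffice because `L > 0`; the annealed estimate divides by such a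
rate. -/
theorem tendsto_log_div_of_forall_exp_bounds {φ p : ℕ → ℝ} {L : ℝ} (hφ : ∀ᶠ n in atTop, 0 < φ n)
    (hL : 0 < L)
    (hup : ∀ K, 0 < K → K < L → ∀ᶠ n in atTop, p n ≤ Real.exp (-K * φ n))
    (hlow : ∀ K, L < K → ∀ᶠ n in atTop, Real.exp (-K * φ n) ≤ p n) :
    Tendsto (fun n => 1 / φ n * Real.log (p n)) atTop (𝓝 (-L)) := by
  have hp : ∀ᶠ n in atTop, 0 < p n := by
    filter_upwards [hlow (L + 1) (by linarith)] with n h1 using (Real.exp_pos _).trans_le h1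
  rw [tendsto_order]
  constructor
  · intro a ha
    obtain ⟨K, hK1, hK2⟩ := exists_between (lt_neg_of_lt_neg ha)
    filter_upwards [hφ, hp, hlow K hK1] with n h1 h2 h3
    rw [← Real.le_log_iff_exp_le h2] at h3
    rw [one_div_mul_eq_div, lt_div_iff₀ h1]
    nlinarith
  · intro a ha
    have h0 : max (-a) 0 < L := max_lt (by linarith) hL
    obtain ⟨K, hK1, hK2⟩ := exists_between h0
    have hK3 := (le_max_left _ _).trans_lt hK1
    have hK4 := (le_max_right _ _).trans_lt hK1
    filter_upwards [hφ, hp, hup K hK4 hK2] with n h1 h2 h3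
    rw [← Real.log_le_iff_le_exp h2] at h3
    rw [one_div_mul_eq_div, div_lt_iff₀ h1]
    nlinarith

/-! ### Almost sure and large-deviation behaviour of the weights. -/

section Weights

variable {Ω : Type*} [MeasurableSpace Ω] {μ : Measure Ω} [IsProbabilityMeasure μ] {θ : ℕ → Ω → ℝ}

/-- For fixed `a`, all of the first `n` variables lie below `a` with probability `p^n`, where `p <
1`. Rational levels give one null set for every `a`. -/
theorem ae_forall_lt_essSup_exists_le (hθ : ∀ j, Measurable (θ j)) (hind : iIndepFun θ μ)
    (hid : ∀ j, IdentDistrib (θ j) (θ 0) μ μ)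
    (hlow : IsBoundedUnder (· ≥ ·) (ae μ) (θ 0)) :
    ∀ᵐ ω ∂μ, ∀ a < essSup (θ 0) μ, ∃ j, a ≤ θ j ω := by
  have key : ∀ a < essSup (θ 0) μ, ∀ᵐ ω ∂μ, ∃ j, a ≤ θ j ω := by
    intro a ha
    have hp : μ (θ 0 ⁻¹' Set.Iio a) < 1 := by
      refine lt_of_le_of_ne prob_le_one fun h1 => ?_
      have h2 : ∀ᵐ ω ∂μ, θ 0 ω ∈ Set.Iio a := by
        rw [← mem_ae_iff_prob_eq_one (hθ 0 measurableSet_Iio)] at h1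
        exact h1
      exact absurd (essSup_le_of_ae_le a (h2.mono fun ω h => le_of_lt h)
        hlow.isCoboundedUnder_le) (not_le.2 ha)
    have hle : ∀ n : ℕ, μ {ω | ¬ ∃ j, a ≤ θ j ω} ≤ μ (θ 0 ⁻¹' Set.Iio a) ^ n := by
      intro n
      calc μ {ω | ¬ ∃ j, a ≤ θ j ω} ≤ μ (⋂ j ∈ Finset.range n, θ j ⁻¹' Set.Iio a) := by
            refine measure_mono fun ω hω => ?_
            simp only [Set.mem_ofPred_eq, not_exists, not_le] at hω
            simp only [Set.mem_iInter]
            exact fun j _ => hω j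
        _ = ∏ j ∈ Finset.range n, μ (θ j ⁻¹' Set.Iio a) :=
            hind.measure_inter_preimage_eq_mul _ fun _ _ => measurableSet_Iio
        _ = _ := by
            rw [Finset.prod_congr rfl fun j _ => (hid j).measure_mem_eq measurableSet_Iio]
            simp
    rw [ae_iff]
    exact le_antisymm (ge_of_tendsto' (ENNReal.tendsto_pow_atTop_nhds_zero_of_lt_one hp) hle)
      bot_le
  have h1 : ∀ᵐ ω ∂μ, ∀ q : ℚ, (q : ℝ) < essSup (θ 0) μ → ∃ j, (q : ℝ) ≤ θ j ω := by
    rw [ae_all_iff]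
    intro q
    by_cases hq : (q : ℝ) < essSup (θ 0) μ
    · exact (key q hq).mono fun ω h _ => h
    · exact ae_of_all _ fun ω h => absurd h hq
  filter_upwards [h1] with ω h a ha
  obtain ⟨q, hq1, hq2⟩ := exists_rat_btwn ha
  obtain ⟨j, hj⟩ := h q hq2
  exact ⟨j, hq1.le.trans hj⟩

/-- Hoeffding's inequality. A rate linear in `n` is needed so that the exceptional event is
negligible at speed `b(n) n^r`. -/
theorem exists_measureReal_sum_lt_le_exp (hθ : ∀ j, Measurable (θ j)) (hind : iIndepFun θ μ)
    (hid : ∀ j, IdentDistrib (θ j) (θ 0) μ μ) {M : ℝ} (hM : 0 < M)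
    (hbd : ∀ᵐ ω ∂μ, θ 0 ω ∈ Set.Icc 0 M) {c : ℝ} (hc : c < ∫ ω, θ 0 ω ∂μ) :
    ∃ lam : ℝ, 0 < lam ∧ ∀ n : ℕ, 1 ≤ n →
      μ.real {ω | ∑ i ∈ Finset.range n, θ i ω < n * c} ≤ Real.exp (-lam * n) := by
  set e := ∫ ω, θ 0 ω ∂μ with he
  have hbdj : ∀ j, ∀ᵐ ω ∂μ, θ j ω ∈ Set.Icc 0 M := fun j =>
    (hid j).symm.ae_mem_snd measurableSet_Icc hbd
  set d : NNReal := (‖M - 0‖₊ / 2) ^ 2 with hd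
  have hd0 : (0 : ℝ) < d := by
    rw [hd]
    have : (0 : ℝ) < ‖M‖ := norm_pos_iff.2 hM.ne'
    push_cast
    simp only [sub_zero]
    positivity
  have hsg : ∀ j, HasSubgaussianMGF (fun ω => -(θ j ω - e)) d μ := by
    intro j
    have h1 := (hasSubgaussianMGF_of_mem_Icc (hθ j).aemeasurable (hbdj j)).neg
    rw [(hid j).integral_eq] at h1
    exact h1
  have hind' : iIndepFun (fun j ω => -(θ j ω - e)) μ :=
    hind.comp (fun _ z => -(z - e)) fun _ => by fun_prop
  have hec : 0 < e - c := by linarith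
  refine ⟨(e - c) ^ 2 / (2 * d), by positivity, fun n hn => ?_⟩
  have hn0 : (0 : ℝ) < n := by exact_mod_cast hn
  have h1 := HasSubgaussianMGF.measure_sum_range_ge_le_of_iIndepFun hind' (n := n)
    (fun j _ => hsg j) (ε := n * (e - c)) (by positivity)
  have h2 : {ω | ∑ i ∈ Finset.range n, θ i ω < n * c} ⊆
      {ω | n * (e - c) ≤ ∑ i ∈ Finset.range n, -(θ i ω - e)} := by
    intro ω hω
    simp only [Set.mem_ofPred_eq, Finset.sum_neg_distrib, Finset.sum_sub_distrib,
      Finset.sum_const, Finset.card_range, nsmul_eq_mul] at hω ⊢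
    linarith
  refine (measureReal_mono h2).trans (h1.trans (le_of_eq ?_))
  congr 1
  field_simp

end Weights

/-! ### The quenched and annealed limits. -/

theorem theorem2 {Ω : Type*} [MeasurableSpace Ω] (μ : Measure Ω) [IsProbabilityMeasure μ]
    (X θ : ℕ → Ω → ℝ)
    -- the `X_j` are i.i.d. with finite moments of all orders
    (hX_meas : ∀ j, Measurable (X j))
    (hX_indep : iIndepFun X μ)
    (hX_ident : ∀ j, IdentDistrib (X j) (X 0) μ μ)
    (hX_moments : ∀ k : ℕ, Integrable (fun ω => X 0 ω ^ k) μ)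
    -- stretched exponential upper tails
    (r : ℝ) (hr0 : 0 < r) (hr1 : r < 1)
    (b c₁ c₂ : ℝ → ℝ)
    (hb : SlowlyVarying b) (hc₁ : SlowlyVarying c₁) (hc₂ : SlowlyVarying c₂)
    (tstar : ℝ) (htstar : 0 < tstar)
    (h_tail : ∀ t : ℝ, tstar ≤ t →
      c₁ t * Real.exp (-(b t) * t ^ r) ≤ μ.real {ω | t ≤ X 0 ω} ∧
      μ.real {ω | t ≤ X 0 ω} ≤ c₂ t * Real.exp (-(b t) * t ^ r))
    -- the `θ_j` are i.i.d., strictly positive and essentially bounded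
    (hθ_meas : ∀ j, Measurable (θ j))
    (hθ_indep : iIndepFun θ μ)
    (hθ_ident : ∀ j, IdentDistrib (θ j) (θ 0) μ μ)
    (hθ_pos : ∀ᵐ ω ∂μ, 0 < θ 0 ω)
    (hθ_bdd : ∃ C : ℝ, ∀ᵐ ω ∂μ, θ 0 ω ≤ C)
    -- the two sequences are independent of each other
    (hXθ_indep : IndepFun (fun (ω : Ω) (j : ℕ) => X j ω) (fun (ω : Ω) (j : ℕ) => θ j ω) μ)
    (x : ℝ) (hx : (∫ ω, X 0 ω ∂μ) < x) :
    -- quenched: conditional probability given `θ_0, θ_1, …`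
    (∀ᵐ ω ∂μ, Tendsto
      (fun n : ℕ => 1 / (b n * (n : ℝ) ^ r) *
        Real.log ((μ⟦{ω' | x ≤ randomWeightedSum θ X n ω'} | sigmaOfSequence θ⟧) ω))
      atTop
      (𝓝 (-(((∫ ω', θ 0 ω' ∂μ) / essSup (θ 0) μ) * (x - ∫ ω', X 0 ω' ∂μ)) ^ r))) ∧
    -- annealed
    Tendsto
      (fun n : ℕ => 1 / (b n * (n : ℝ) ^ r) *
        Real.log (μ.real {ω | x ≤ randomWeightedSum θ X n ω}))
      atTop
      (𝓝 (-(((∫ ω, θ 0 ω ∂μ) / essSup (θ 0) μ) * (x - ∫ ω, X 0 ω ∂μ)) ^ r)) := by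
  have hX2 : MemLp (X 0) 2 μ :=
    (memLp_two_iff_integrable_sq (hX_meas 0).aestronglyMeasurable).2 (hX_moments 2)
  obtain ⟨hpos, hF⟩ := tendsto_log_div_of_slowlyVarying_bounds
    (F := fun t => μ.real {ω | t ≤ X 0 ω}) hr0 hb hc₁ hc₂
    (eventually_atTop.2 ⟨tstar, h_tail⟩)
  set m := ∫ ω, X 0 ω ∂μ with hm
  set M := essSup (θ 0) μ with hMdef
  set e := ∫ ω, θ 0 ω ∂μ with he
  have hxm : 0 < x - m := by linarith
  obtain ⟨C₀, hC₀⟩ := hθ_bdd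
  have hbdd : IsBoundedUnder (· ≤ ·) (ae μ) (θ 0) := ⟨C₀, hC₀⟩
  have hbdd' : IsBoundedUnder (· ≥ ·) (ae μ) (θ 0) := ⟨0, hθ_pos.mono fun ω h => h.le⟩
  have hθM : ∀ᵐ ω ∂μ, θ 0 ω ≤ M := ae_le_essSup hbdd
  have hM : 0 < M := by
    obtain ⟨ω, h1, h2⟩ := (hθ_pos.and hθM).exists
    exact h1.trans_le h2
  have hIcc : ∀ᵐ ω ∂μ, θ 0 ω ∈ Set.Icc 0 M := by
    filter_upwards [hθ_pos, hθM] with ω h1 h2 using ⟨h1.le, h2⟩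
  have hall : ∀ᵐ ω ∂μ, ∀ j, 0 ≤ θ j ω ∧ θ j ω ≤ M :=
    ae_all_iff.2 fun j => (hθ_ident j).symm.ae_mem_snd measurableSet_Icc hIcc
  have hθint : Integrable (θ 0) μ := Integrable.of_mem_Icc 0 M (hθ_meas 0).aemeasurable hIcc
  have he0 : 0 < e := by
    rw [he, integral_pos_iff_support_of_nonneg_ae (hθ_pos.mono fun ω h => h.le) hθint]
    have h1 : ∀ᵐ ω ∂μ, ω ∈ Function.support (θ 0) := hθ_pos.mono fun ω h => h.ne'
    refine pos_of_ne_zero fun h0 => ?_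
    obtain ⟨ω, h2, h3⟩ := (h1.and (measure_eq_zero_iff_ae_notMem.1 h0)).exists
    exact h3 h2
  set L := (e / M * (x - m)) ^ r with hL
  have hL0 : 0 < L := by positivity
  have hslln : ∀ᵐ ω ∂μ, Tendsto (fun n : ℕ => (∑ i ∈ Finset.range n, θ i ω) / n) atTop (𝓝 e) :=
    strong_law_ae_real θ hθint (fun i j hij => hθ_indep.indepFun hij) hθ_ident
  have hmax := ae_forall_lt_essSup_exists_le hθ_meas hθ_indep hθ_ident hbdd'
  have hφ : Tendsto (fun n : ℕ => b n * (n : ℝ) ^ r) atTop atTop :=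
    (hb.tendsto_mul_rpow_atTop hr0).comp tendsto_natCast_atTop_atTop
  have hφn : Tendsto (fun n : ℕ => b n * (n : ℝ) ^ r / n) atTop (𝓝 0) :=
    (hb.tendsto_mul_rpow_div_zero hr1).comp tendsto_natCast_atTop_atTop
  set G : ℕ → (ℕ → ℝ) → ℝ := fun n t =>
    μ.real {ω | x ≤ ∑ j ∈ Finset.range n, t j / (∑ i ∈ Finset.range n, t i) * X j ω} with hG
  have hupper : ∀ K, K < L → ∃ c, c < e ∧ ∀ᶠ n : ℕ in atTop, ∀ t : ℕ → ℝ,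
      (∀ j, 0 ≤ t j ∧ t j ≤ M) → n * c ≤ ∑ i ∈ Finset.range n, t i →
      G n t ≤ Real.exp (-K * (b n * (n : ℝ) ^ r)) := by
    intro K hK
    have h1 : Tendsto (fun c => (c * (x - m) / M) ^ r) (𝓝[<] e) (𝓝 ((e * (x - m) / M) ^ r)) :=
      Tendsto.rpow_const ((Continuous.tendsto (by fun_prop) _).mono_left nhdsWithin_le_nhds)
        (Or.inr hr0.le)
    have h2 := h1.eventually (lt_mem_nhds (a := K)
      (by rwa [hL, div_mul_eq_mul_div] at hK))
    obtain ⟨c, hc1, hc0, hce⟩ := (h2.and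
      ((eventually_nhdsWithin_of_eventually_nhds (lt_mem_nhds he0)).and self_mem_nhdsWithin)).exists
    exact ⟨c, hce, eventually_measureReal_weighted_sum_le hX_meas hX_indep hX_ident hX2 hr0 hr1 hb
      hpos hF hx hc0 hM hc1⟩
  -- The rate depends only on `C` near `e` and `M'` near `M`; the lower bound `e / 2` merely keeps
  -- each weight of order `1 / n`.
  have hlower : ∀ K, L < K → ∃ C > e, ∃ M' < M, ∀ᶠ n : ℕ in atTop, ∀ t : ℕ → ℝ,
      (∀ j, 0 ≤ t j ∧ t j ≤ M) → n * (e / 2) ≤ ∑ i ∈ Finset.range n, t i →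
      ∑ i ∈ Finset.range n, t i ≤ n * C → (∃ j < n, M' ≤ t j) →
      Real.exp (-K * (b n * (n : ℝ) ^ r)) ≤ G n t := by
    intro K hK
    have h1 : Tendsto (fun ε => ((e + ε) * (x - m) / (M - ε)) ^ r) (𝓝[>] 0)
        (𝓝 (((e + 0) * (x - m) / (M - 0)) ^ r)) := by
      refine Tendsto.rpow_const (Tendsto.mono_left ?_ nhdsWithin_le_nhds) (Or.inr hr0.le)
      refine Tendsto.div ?_ ?_ (by simpa using hM.ne')
      · exact Continuous.tendsto (by fun_prop) _
      · exact Continuous.tendsto (by fun_prop) _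
    have h2 := h1.eventually_lt_const (u := K)
      (by rwa [add_zero, sub_zero, ← div_mul_eq_mul_div])
    obtain ⟨ε, hε1, hεM, hε0⟩ := (h2.and
      ((eventually_nhdsWithin_of_eventually_nhds (gt_mem_nhds hM)).and self_mem_nhdsWithin)).exists
    have hε0' : 0 < ε := hε0
    exact ⟨e + ε, by linarith, M - ε, by linarith,
      eventually_le_measureReal_weighted_sum hX_meas hX_indep hX_ident hX2 hr0 hb
      hpos hF hx (half_pos he0) (by linarith) hM (by linarith) hε1⟩
  have hUm : Measurable fun (ω : Ω) (j : ℕ) => X j ω := measurable_pi_lambda _ hX_meas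
  have hVm : Measurable fun (ω : Ω) (j : ℕ) => θ j ω := measurable_pi_lambda _ hθ_meas
  have hA : ∀ n : ℕ, MeasurableSet {p : (ℕ → ℝ) × (ℕ → ℝ) |
      x ≤ ∑ j ∈ Finset.range n, p.2 j / (∑ i ∈ Finset.range n, p.2 i) * p.1 j} := fun n =>
    measurableSet_le measurable_const (by fun_prop)
  have hcond : ∀ n : ℕ, μ⟦{ω' | x ≤ randomWeightedSum θ X n ω'} | sigmaOfSequence θ⟧ =ᵐ[μ]
      fun ω => G n fun j => θ j ω := fun n =>
    condExp_comap_indicator_ae_eq_of_indepFun hUm hVm hXθ_indep (hA n)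
  have hevent : ∀ n : ℕ, MeasurableSet {ω | x ≤ randomWeightedSum θ X n ω} := fun n =>
    (hUm.prodMk hVm) (hA n)
  have hsumlow : ∀ᵐ ω ∂μ, ∀ c < e, ∀ᶠ n : ℕ in atTop,
      n * c ≤ ∑ i ∈ Finset.range n, θ i ω := by
    filter_upwards [hslln] with ω h c hc
    filter_upwards [h.eventually (lt_mem_nhds hc), eventually_ge_atTop 1] with n h1 hn
    have hn0 : (0 : ℝ) < n := by exact_mod_cast hn
    rw [lt_div_iff₀ hn0] at h1
    linarith
  have hgood : ∀ᵐ ω ∂μ, ∀ C > e, ∀ M' < M, ∀ᶠ n : ℕ in atTop,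
      (n * (e / 2) ≤ ∑ i ∈ Finset.range n, θ i ω ∧ ∑ i ∈ Finset.range n, θ i ω ≤ n * C) ∧
        ∃ j < n, M' ≤ θ j ω := by
    filter_upwards [hslln, hmax, hsumlow] with ω h1 h2 h3 C hC M' hM'
    obtain ⟨j, hj⟩ := h2 M' hM'
    filter_upwards [h3 _ (half_lt_self he0), h1.eventually (gt_mem_nhds hC), eventually_gt_atTop j] with n h4 h5 hn
    have hn0 : (0 : ℝ) < n := by exact_mod_cast (Nat.zero_le j).trans_lt hn
    rw [div_lt_iff₀ hn0] at h5
    exact ⟨⟨h4, by linarith⟩, j, hn, hj⟩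
  constructor
  · filter_upwards [ae_all_iff.2 hcond, hall, hsumlow, hgood] with ω h1 h2 h3 h4
    refine tendsto_log_div_of_forall_exp_bounds (hφ.eventually_gt_atTop 0) hL0 ?_ ?_
    · intro K _ hK
      obtain ⟨c, hc, h5⟩ := hupper K hK
      filter_upwards [h5, h3 c hc] with n h6 h7
      rw [h1 n]
      exact h6 _ h2 h7
    · intro K hK
      obtain ⟨C, hC, M', hM', h5⟩ := hlower K hK
      filter_upwards [h5, h4 C hC M' hM'] with n h6 h7
      rw [h1 n]
      exact h6 _ h2 h7.1.1 h7.1.2 h7.2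
  · have hGint : ∀ n, Integrable (fun ω => G n fun j => θ j ω) μ := fun n =>
      integrable_condExp.congr (hcond n)
    have hp : ∀ n : ℕ, μ.real {ω | x ≤ randomWeightedSum θ X n ω} =
        ∫ ω, G n (fun j => θ j ω) ∂μ := by
      intro n
      rw [← integral_congr_ae (hcond n), integral_condExp hVm.comap_le,
        integral_indicator (hevent n)]
      simp
    have hG0 : ∀ n t, 0 ≤ G n t := fun n t => measureReal_nonneg
    have hG1 : ∀ n t, G n t ≤ 1 := fun n t => measureReal_le_one
    refine tendsto_log_div_of_forall_exp_bounds (hφ.eventually_gt_atTop 0) hL0 ?_ ?_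
    · intro K hK0 hK
      -- The slack `K₁ - K` absorbs the factor 2 from adding the bad-event probability to the
      -- typical contribution.
      obtain ⟨K₁, hKK₁, hK₁⟩ := exists_between hK
      obtain ⟨c, hc, h5⟩ := hupper K₁ hK₁
      obtain ⟨lam, hlam, h6⟩ := exists_measureReal_sum_lt_le_exp hθ_meas hθ_indep hθ_ident hM
        hIcc hc
      filter_upwards [h5, eventually_ge_atTop 1,
        hφ.eventually_ge_atTop (Real.log 2 / (K₁ - K)),
        hφn.eventually (gt_mem_nhds (show 0 < lam / K₁ by
          have := hK0.trans hKK₁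
          positivity))] with n h7 hn h8 h9
      have hn0 : (0 : ℝ) < n := by exact_mod_cast hn
      set φ := b n * (n : ℝ) ^ r
      have hK₁0 := hK0.trans hKK₁
      rw [hp n]
      have hbad : MeasurableSet {ω | ∑ i ∈ Finset.range n, θ i ω < n * c} :=
        measurableSet_lt (by fun_prop) measurable_const
      calc ∫ ω, G n (fun j => θ j ω) ∂μ
          ≤ ∫ ω, ({ω | ∑ i ∈ Finset.range n, θ i ω < n * c}.indicator (fun _ => (1 : ℝ)) ω +
              Real.exp (-K₁ * φ)) ∂μ := by
            refine integral_mono_ae (hGint n)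
              (((integrable_const 1).indicator hbad).add (integrable_const _)) ?_
            filter_upwards [hall] with ω h10
            by_cases h11 : ∑ i ∈ Finset.range n, θ i ω < n * c
            · rw [Set.indicator_of_mem (by exact h11)]
              linarith [hG1 n fun j => θ j ω, Real.exp_pos (-K₁ * φ)]
            · rw [Set.indicator_of_notMem (by exact h11), zero_add]
              exact h7 _ h10 (not_lt.1 h11)
        _ = μ.real {ω | ∑ i ∈ Finset.range n, θ i ω < n * c} + Real.exp (-K₁ * φ) := by
            rw [integral_add ((integrable_const 1).indicator hbad) (integrable_const _),
              integral_indicator hbad]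
            simp
        _ ≤ Real.exp (-K₁ * φ) + Real.exp (-K₁ * φ) := by
            gcongr
            refine (h6 n hn).trans (Real.exp_le_exp.2 ?_)
            rw [div_lt_div_iff₀ hn0 hK₁0] at h9
            linarith
        _ = Real.exp (Real.log 2 + -K₁ * φ) := by
            rw [Real.exp_add, Real.exp_log (by norm_num)]
            ring
        _ ≤ Real.exp (-K * φ) := by
            rw [div_le_iff₀ (by linarith)] at h8
            gcongr
            linarith
    · intro K hK
      obtain ⟨K₁, hK₁, hKK₁⟩ := exists_between hK
      obtain ⟨C, hC, M', hM', h5⟩ := hlower K₁ hK₁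
      -- Here no rate is needed: the good event has probability tending to 1, so restricting to it
      -- costs at most a factor `1/2`.
      set E : ℕ → Set Ω := fun n => {ω | (n * (e / 2) ≤ ∑ i ∈ Finset.range n, θ i ω ∧
        ∑ i ∈ Finset.range n, θ i ω ≤ n * C) ∧ ∃ j < n, M' ≤ θ j ω} with hE
      have hEm : ∀ n, MeasurableSet (E n) := by
        intro n
        refine MeasurableSet.inter (MeasurableSet.inter ?_ ?_) ?_
        · exact measurableSet_le measurable_const
            (Finset.measurable_fun_sum _ fun i _ => hθ_meas i)
        · exact measurableSet_le (Finset.measurable_fun_sum _ fun i _ => hθ_meas i)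
            measurable_const
        · refine MeasurableSet.congr (s := ⋃ j, ⋃ (_ : j < n), {ω | M' ≤ θ j ω}) ?_ ?_
          · exact MeasurableSet.iUnion fun j => MeasurableSet.iUnion fun _ =>
              measurableSet_le measurable_const (hθ_meas j)
          · ext ω
            simp only [Set.mem_iUnion]
            exact ⟨fun ⟨j, h1, h2⟩ => ⟨j, h1, h2⟩, fun ⟨j, h1, h2⟩ => ⟨j, h1, h2⟩⟩
      have hEt : Tendsto (fun n => μ (E n)) atTop (𝓝 (μ Set.univ)) := by
        refine tendsto_measure_of_ae_tendsto_indicator_of_isFiniteMeasure atTop MeasurableSet.univ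
          hEm ?_
        filter_upwards [hgood] with ω h
        filter_upwards [h C hC M' hM'] with n h1
        exact ⟨fun _ => trivial, fun _ => h1⟩
      rw [measure_univ] at hEt
      have hEr : Tendsto (fun n => μ.real (E n)) atTop (𝓝 1) :=
        (ENNReal.tendsto_toReal ENNReal.one_ne_top).comp hEt
      filter_upwards [h5, hφ.eventually_ge_atTop (Real.log 2 / (K - K₁)),
        hEr.eventually (lt_mem_nhds (show (1 / 2 : ℝ) < 1 by norm_num))] with n h6 h7 h8
      set φ := b n * (n : ℝ) ^ r
      rw [hp n]
      calc Real.exp (-K * φ) ≤ Real.exp (-Real.log 2 + -K₁ * φ) := by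
            rw [div_le_iff₀ (by linarith)] at h7
            gcongr
            linarith
        _ = 1 / 2 * Real.exp (-K₁ * φ) := by
            rw [Real.exp_add, Real.exp_neg, Real.exp_log (by norm_num), one_div]
        _ ≤ μ.real (E n) * Real.exp (-K₁ * φ) := by gcongr
        _ = ∫ ω, (E n).indicator (fun _ => Real.exp (-K₁ * φ)) ω ∂μ := by
            rw [integral_indicator (hEm n)]
            simp
        _ ≤ ∫ ω, G n (fun j => θ j ω) ∂μ := by
            refine integral_mono_ae ((integrable_const _).indicator (hEm n)) (hGint n) ?_
            filter_upwards [hall] with ω h10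
            by_cases h11 : ω ∈ E n
            · rw [Set.indicator_of_mem h11]
              exact h6 _ h10 h11.1.1 h11.1.2 h11.2
            · rw [Set.indicator_of_notMem h11]
              exact hG0 _ _
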